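/- Let $X\subseteq(0,\infty)$ carry the Borel $\sigma$-algebra and an s-finite (for example $\sigma$-finite) measure $\mu$, and let $m\ge 0$ be an integer. Put $\phi_i(x)=x^i$ for $0\le i\le 2m-1$ and $\epsilon(x,y)=\frac{x-y}{x+y}$. Assume that the moments $$M_{i,j}=\int_{X}\int_{X}\phi_i(x)\phi_j(y)\,\epsilon(x,y)\,d\mu(x)\,d\mu(y),\qquad 0\le i,j\le 2m-1,$$ exist (the integrands are $\mu\otimes\mu$-integrable), and that $\mu$ is not concentrated on fewer than $2m$ points, that is, $\mu(X\setminus F)>0$ for every $F\subset X$ with fewer than $2m$ elements. Let $$\tau_{2m}=\frac1{(2m)!}\int_{X^{2m}}\prod_{1\le i<j\le 2m}\frac{(x_i-x_j)^2}{x_i+x_j}\prod_{i=1}^{2m}d\mu(x_i)$$ be the partition function of the Bures ensemble. (For $X=(0,\infty)$ and $d\mu(x)=\omega(x)\exp\bigl(\sum_{k\ge1\text{ odd}}t_kx^k\bigr)dx$ this is the matrix integral $\tau$-function of the BKP hierarchy.) Then: 1. The matrix $M=(M_{i,j})$ is skew-symmetric and invertible. 2. The integral $\tau_{2m}$ converges,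 and $\tau_{2m}=(-1)^m\,\mathrm{Pf}(M)>0$. 3. The functions $(\epsilon\cdot\phi_j)(x)=\int_X\epsilon(x,y)\,\phi_j(y)\,d\mu(y)$ are well defined for every $x\in X$, and the $2\times2$ matrix kernel $$K(x,y)=\begin{pmatrix}\sum_{i,j}\phi_i(x)M^{-T}_{i,j}\phi_j(y)&\sum_{i,j}\phi_i(x)M^{-T}_{i,j}(\epsilon\cdot\phi_j)(y)\\ \sum_{i,j}(\epsilon\cdot\phi_i)(x)M^{-T}_{i,j}\phi_j(y)&-\epsilon(x,y)+\sum_{i,j}(\epsilon\cdot\phi_i)(x)M^{-T}_{i,j}(\epsilon\cdot\phi_j)(y)\end{pmatrix},$$ with sums over $0\le i,j\le 2m-1$ and $M^{-T}=(M^{-1})^{T}$, is skew-symmetric: $K(x,y)^T=-K(y,x)$. 4. For every $0\le l\le 2m$ and all $x_1,\dots,x_l\in X$, the correlation function $$R(x_1,\dots,x_l)=\frac{1}{(2m-l)!\,(-1)^m\,\mathrm{Pf}(M)}\int_{X^{2m-l}}\prod_{1\le i<j\le 2m}\frac{(x_i-x_j)^2}{x_i+x_j}\prod_{j=l+1}^{2m}d\mu(x_j)$$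 is given by a convergent integral, and $$R(x_1,\dots,x_l)=\mathrm{Pf}\bigl(K(x_i,x_j)\bigr)_{1\le i,j\le l},$$ the Pfaffian of the $2l\times2l$ matrix made of the $2\times2$ blocks $K(x_i,x_j)$. 5. $\tau_{2m}$ induces a Pfaffian point process: the measure on $X^{2m}$ with density $\frac{1}{(2m)!\,\tau_{2m}}\prod_{i<j}\frac{(z_i-z_j)^2}{z_i+z_j}$ with respect to $\mu^{\otimes 2m}$ is a probability measure, the points $z_1,\dots,z_{2m}$ are almost surely distinct, and for every $l\ge0$ the function $(x_1,\dots,x_l)\mapsto\mathrm{Pf}(K(x_i,x_j))_{1\le i,j\le l}$ is nonnegative and is the $l$-point correlation function of the random configuration $\{z_1,\dots,z_{2m}\}$ with respect to $\mu$: for every measurable $f:X^l\to[0,\infty]$, $$\mathbb E\Bigl[\sum_{(i_1,\dots,i_l)\text{ distinct}}f(z_{i_1},\dots,z_{i_l})\Bigr]=\int_{X^l}f(x_1,\dots,x_l)\,\mathrm{Pf}\bigl(K(x_i,x_j)\bigr)_{1\le i,j\le l}\,d\mu(x_1)\cdots d\mu(x_l).$$ -/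

import Mathlib

open MeasureTheory
open scoped ENNReal Nat

noncomputable section

/-- The Pfaffian of a (skew-symmetric) matrix of even order `2n`:
`Pf A = 1 / (2^n n!) * ∑_σ sgn σ * ∏_{i < n} A (σ (2i)) (σ (2i+1))`, rows indexed from `0`. -/
def pfaffian {n : ℕ} (A : Matrix (Fin (2 * n)) (Fin (2 * n)) ℝ) : ℝ :=
  (1 / ((2 : ℝ) ^ n * (n ! : ℝ))) *
    ∑ σ : Equiv.Perm (Fin (2 * n)), ((Equiv.Perm.sign σ : ℤ) : ℝ) *
      ∏ i : Fin n, A (σ ⟨2 * (i : ℕ), by omega⟩) (σ ⟨2 * (i : ℕ) + 1, by omega⟩)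

/-- For a `2 × 2`-matrix valued kernel `K` and points `x_0, …, x_{l-1}`, the `2l × 2l` matrix made
of the `2 × 2` blocks `K (x_i) (x_j)`. -/
def kernelMatrix {X : Type*} (K : X → X → Matrix (Fin 2) (Fin 2) ℝ) {l : ℕ} (x : Fin l → X) :
    Matrix (Fin (2 * l)) (Fin (2 * l)) ℝ :=
  Matrix.of fun a b =>
    K (x ⟨(a : ℕ) / 2, by omega⟩) (x ⟨(b : ℕ) / 2, by omega⟩)
      ⟨(a : ℕ) % 2, by omega⟩ ⟨(b : ℕ) % 2, by omega⟩

/-- `P` is the law of `N` points `z_0, …, z_{N-1}` of `X`. The random configuration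
`{z_0, …, z_{N-1}}` is a Pfaffian point process with kernel `K` (with respect to the reference
measure `μ`) if the points are almost surely distinct and, for every `l`, the function
`x ↦ Pf (K (x_i, x_j))_{i, j < l}` is nonnegative and is the `l`-point correlation function, that
is, the density with respect to `μ^l` of the measure that counts the ordered `l`-tuples of distinct
points of the configuration. -/
structure IsPfaffianPointProcess {X : Type*} [MeasurableSpace X] {N : ℕ}
    (P : Measure (Fin N → X)) (μ : Measure X) (K : X → X → Matrix (Fin 2) (Fin 2) ℝ) : Prop where
  isProbabilityMeasure : IsProbabilityMeasure P
  ae_injective : ∀ᵐ z ∂P, Function.Injective z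
  pfaffian_nonneg : ∀ (l : ℕ) (x : Fin l → X), 0 ≤ pfaffian (kernelMatrix K x)
  lintegral_sum : ∀ (l : ℕ) (f : (Fin l → X) → ℝ≥0∞), Measurable f →
    ∫⁻ z, ∑ e : Fin l ↪ Fin N, f (z ∘ e) ∂P =
      ∫⁻ x, f x * ENNReal.ofReal (pfaffian (kernelMatrix K x)) ∂(Measure.pi fun _ : Fin l => μ)

/-- The skew-symmetric function `ε(x, y) = (x - y) / (x + y)`. -/
def buresEps (x y : ℝ) : ℝ := (x - y) / (x + y)

/-- The (unnormalized) Bures density `∏_{i < j} (z_i - z_j)² / (z_i + z_j)`. -/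
def buresDensity {n : ℕ} (z : Fin n → ℝ) : ℝ :=
  ∏ i : Fin n, ∏ j ∈ Finset.Ioi i, (z i - z j) ^ 2 / (z i + z j)

variable {X : Set ℝ}

/-- The partition function `τ_n = 1/n! ∫_{X^n} ∏_{i < j} (x_i - x_j)² / (x_i + x_j) ∏ dμ(x_i)`. -/
def buresTau (n : ℕ) (μ : Measure X) : ℝ :=
  (1 / (n ! : ℝ)) * ∫ z, buresDensity (fun i => (z i : ℝ)) ∂(Measure.pi fun _ : Fin n => μ)

/-- The moments `M_{i,j} = ∫∫ x^i y^j ε(x, y) dμ(x) dμ(y)`, `0 ≤ i, j ≤ 2m - 1`. -/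
def buresMoment (m : ℕ) (μ : Measure X) : Matrix (Fin (2 * m)) (Fin (2 * m)) ℝ :=
  Matrix.of fun i j =>
    ∫ p : X × X, (p.1 : ℝ) ^ (i : ℕ) * (p.2 : ℝ) ^ (j : ℕ) * buresEps p.1 p.2 ∂(μ.prod μ)

/-- The function `ε · φ_j`, where `φ_j(y) = y^j`: `(ε · φ_j)(x) = ∫ ε(x, y) y^j dμ(y)`. -/
def epsDot (μ : Measure X) (j : ℕ) (x : X) : ℝ :=
  ∫ y : X, buresEps x y * (y : ℝ) ^ j ∂μ

/-- The `2 × 2` matrix kernel `K(x, y)`. -/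
def buresKernel (m : ℕ) (μ : Measure X) (x y : X) : Matrix (Fin 2) (Fin 2) ℝ :=
  let A : Matrix (Fin (2 * m)) (Fin (2 * m)) ℝ := ((buresMoment m μ)⁻¹).transpose
  !![∑ i : Fin (2 * m), ∑ j : Fin (2 * m), (x : ℝ) ^ (i : ℕ) * A i j * (y : ℝ) ^ (j : ℕ),
     ∑ i : Fin (2 * m), ∑ j : Fin (2 * m), (x : ℝ) ^ (i : ℕ) * A i j * epsDot μ j y;
     ∑ i : Fin (2 * m), ∑ j : Fin (2 * m), epsDot μ i x * A i j * (y : ℝ) ^ (j : ℕ),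
     -buresEps x y + ∑ i : Fin (2 * m), ∑ j : Fin (2 * m), epsDot μ i x * A i j * epsDot μ j y]

/-- The Bures density as a function of the last `k` of `l + k` points, the first `l` points
`x_0, …, x_{l-1}` being fixed. -/
def buresSection {l : ℕ} (x : Fin l → X) (k : ℕ) (y : Fin k → X) : ℝ :=
  buresDensity fun i => ((Fin.append x y i : X) : ℝ)

/-- The correlation function of `l ≤ 2m` points,
`R(x_0, …, x_{l-1}) = 1 / ((2m-l)! (-1)^m Pf M) ∫_{X^{2m-l}} ∏_{i < j} (x_i - x_j)² / (x_i + x_j)`,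
the integral running over the last `2m - l` of the `2m` variables. -/
def buresCorrelation (m : ℕ) (μ : Measure X) {l : ℕ} (x : Fin l → X) : ℝ :=
  (1 / (((2 * m - l)! : ℝ) * ((-1) ^ m * pfaffian (buresMoment m μ)))) *
    ∫ y, buresSection x (2 * m - l) y ∂(Measure.pi fun _ : Fin (2 * m - l) => μ)

/-- The measure on `X^{2m}` with density `1 / ((2m)! τ_{2m}) ∏_{i < j} (z_i - z_j)² / (z_i + z_j)`
with respect to `μ^{2m}`. -/
def buresLaw (m : ℕ) (μ : Measure X) : Measure (Fin (2 * m) → X) :=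
  (Measure.pi fun _ : Fin (2 * m) => μ).withDensity fun z =>
    ENNReal.ofReal (buresDensity (fun i => (z i : ℝ)) / (((2 * m)! : ℝ) * buresTau (2 * m) μ))

end

/-!
The Bures density of `2m` points is a Vandermonde determinant times the Pfaffian of
`ε(z_j, z_i)` (Schur's identity `pfaffian_buresEps`). The theorem follows from the study of one
family of *bordered Pfaffians*: for points `x_1, …, x_l`, let `G(x_1, …, x_l)` be the Pfaffian of
the matrix of size `2m + 2l` whose first diagonal block is `-M`, whose second diagonal block
couples the points through `-ε`, and whose off-diagonal blocks hold the values `φ_i(x_k)` and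
`(ε · φ_i)(x_k)`. Three facts determine everything.

* For `l = 2m` the rows that hold the `φ_i(x_k)` are supported on a square block, and `G` is the
  density; for `l > 2m` it vanishes (`PfaffianSystem.bordered_ofFn`,
  `PfaffianSystem.bordered_of_lt`, `bordered_ofFn_eq_buresDensity`).
* Integrating out one point gives `∫ G(x_1, …, x_l, y) dμ(y) = (2m - l) G(x_1, …, x_l)`
  (`BuresAdmissible.integral_bordered_cons`). Expansion of `G` along the two rows of `y` turns the
  products of functions of `y` into entries of the smaller matrix; the result is the sum of its
  Laplace expansions along the `2m` rows of the functions, minus those along the `l` rows of the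
  `φ_i(x_k)`, each of which equals `G(x_1, …, x_l)`
  (`PfaffianSystem.exists_bordered_cons_eq`).
* The Schur complement of the block `-M` is the matrix of the kernel, so that
  `G(x_1, …, x_l) = G() Pf K(x_i, x_j)` with `G() = (-1)^m Pf M`
  (`PfaffianSystem.bordered_ofFn_eq_pfaffian_kernel`, `PfaffianSystem.bordered_nil`).

By descending induction on `l` the first two facts show that `G` is nonnegative, that it is positive
at distinct points (as `μ` is not concentrated on fewer than `2m` points), and that it is, up to a
factorial, the integral of the density over the remaining points. In particular `(-1)^m Pf M` is
positive and equals `τ_{2m}`, so `M` is invertible and the third fact applies. Integrability rests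
on the remark that the existence of the moments forces every `x^i`, `i < 2m`, to be integrable
(`BuresAdmissible.integrable_pow`).

Pfaffians are handled through the exterior algebra. An alternating form `B` defines a linear
functional `wick B` on it, determined by `wick (v ∧ z) = wick (B v ⌋ z)`, whose value on
`v_1 ∧ ⋯ ∧ v_{2n}` is the Pfaffian of `B v_i v_j` (`ExteriorAlgebra.wick_ιMulti_eq_pfaffian`). The
expansions and the Schur complement formula (`ExteriorAlgebra.wick_list_prod_mul`) then become
short computations with contractions.
-/

/-! ### Contractions in the exterior algebra -/

namespace ExteriorAlgebra

open CliffordAlgebra (contractLeft contractLeft_ι_mul contractLeft_one contractLeft_comm)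

variable {R : Type*} [CommRing R] {M : Type*} [AddCommGroup M] [Module R M]

theorem ι_mul_ι_swap (u v : M) : ι R u * ι R v = -(ι R v * ι R u) :=
  eq_neg_of_add_eq_zero_left (ι_add_mul_swap u v)

theorem list_prod_mul_ι (l : List M) (u : M) :
    (l.map (ι R)).prod * ι R u = (-1 : R) ^ l.length • (ι R u * (l.map (ι R)).prod) := by
  induction l with
  | nil => simp
  | cons v l ih =>
    rw [List.map_cons, List.prod_cons, mul_assoc, ih, mul_smul_comm, ← mul_assoc, ι_mul_ι_swap v u,
      List.length_cons, pow_succ, mul_neg_one, neg_smul, neg_mul, smul_neg, mul_assoc]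

theorem contractLeft_list_prod_mul {d : Module.Dual R M} {l : List M} (h : ∀ v ∈ l, d v = 0)
    (z : ExteriorAlgebra R M) :
    contractLeft d ((l.map (ι R)).prod * z) =
      (-1 : R) ^ l.length • ((l.map (ι R)).prod * contractLeft d z) := by
  induction l with
  | nil => simp
  | cons v l ih =>
    rw [List.map_cons, List.prod_cons, mul_assoc, contractLeft_ι_mul, h v (by simp),
      ih fun w hw => h w (by simp [hw]), zero_smul, zero_sub, List.length_cons, pow_succ,
      mul_neg_one, neg_smul, mul_smul_comm, mul_assoc]

theorem contractLeft_list_prod {d : Module.Dual R M} {l : List M} (h : ∀ v ∈ l, d v = 0) :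
    contractLeft d (l.map (ι R)).prod = 0 := by
  simpa using contractLeft_list_prod_mul h 1

theorem contractLeft_map {N : Type*} [AddCommGroup N] [Module R N] (g : M →ₗ[R] N)
    (d : Module.Dual R N) (z : ExteriorAlgebra R M) :
    contractLeft d (map g z) = map g (contractLeft (d ∘ₗ g) z) := by
  induction z using CliffordAlgebra.left_induction with
  | algebraMap r =>
    rw [AlgHom.commutes, CliffordAlgebra.contractLeft_algebraMap,
      CliffordAlgebra.contractLeft_algebraMap, map_zero]
  | add x y hx hy => simp only [map_add, hx, hy]
  | ι_mul x v hx =>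
    change contractLeft d (map g (ι R v * x)) = map g (contractLeft (d ∘ₗ g) (ι R v * x))
    rw [map_mul (map g), contractLeft_ι_mul, map_sub, map_smul, map_apply_ι, contractLeft_ι_mul,
      map_mul (map g), map_apply_ι, ← hx]
    rfl

theorem contractLeft_ιMulti_succ (d : Module.Dual R M) (k : ℕ) (v : Fin (k + 1) → M) :
    contractLeft d (ιMulti R (k + 1) v) =
      ∑ j : Fin (k + 1), ((-1 : R) ^ (j : ℕ) * d (v j)) • ιMulti R k (v ∘ j.succAbove) := by
  induction k with
  | zero => simp [Algebra.algebraMap_eq_smul_one]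
  | succ k ih =>
    rw [ιMulti_succ_apply, contractLeft_ι_mul, Matrix.vecTail, ih,
      Fin.sum_univ_succ (n := k + 1), Finset.mul_sum, sub_eq_add_neg, ← Finset.sum_neg_distrib]
    congr 1
    · simp [Function.comp_def]
    · refine Finset.sum_congr rfl fun j _ => ?_
      rw [ιMulti_succ_apply, mul_smul_comm, ← neg_smul]
      congr 1
      · simp [pow_succ]
      · simp only [Function.comp_apply, Matrix.vecTail]
        congr 2
        funext i
        simp

/-- The successive contraction `c(d_k) ⋯ c(d_1) z` of `z` with a list `[d_1, …, d_k]`. -/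
noncomputable def contractList (l : List (Module.Dual R M)) (z : ExteriorAlgebra R M) :
    ExteriorAlgebra R M :=
  l.foldl (fun z d => contractLeft d z) z

theorem contractList_cons (d : Module.Dual R M) (l : List (Module.Dual R M))
    (z : ExteriorAlgebra R M) : contractList (d :: l) z = contractList l (contractLeft d z) := rfl

theorem contractList_add (l : List (Module.Dual R M)) (y z : ExteriorAlgebra R M) :
    contractList l (y + z) = contractList l y + contractList l z := by
  induction l generalizing y z with
  | nil => rfl
  | cons d l ih => simp only [contractList_cons, map_add, ih]

theorem contractList_smul (l : List (Module.Dual R M)) (r : R) (z : ExteriorAlgebra R M) :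
    contractList l (r • z) = r • contractList l z := by
  induction l generalizing z with
  | nil => rfl
  | cons d l ih => simp only [contractList_cons, map_smul, ih]

theorem contractList_sum {α : Type*} (s : Finset α) (l : List (Module.Dual R M))
    (f : α → ExteriorAlgebra R M) :
    contractList l (∑ a ∈ s, f a) = ∑ a ∈ s, contractList l (f a) :=
  map_sum (⟨⟨contractList l, contractList_add l⟩, contractList_smul l⟩ :
    ExteriorAlgebra R M →ₗ[R] ExteriorAlgebra R M) f s

/-- Contracting a product of `k` vectors `k` times gives a determinant; this is the Laplace
expansion along the first row. -/
theorem contractList_ιMulti (k : ℕ) (d : Fin k → Module.Dual R M) (v : Fin k → M) :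
    contractList (List.ofFn d) (ιMulti R k v) =
      algebraMap R _ (Matrix.of fun i j => d i (v j)).det := by
  induction k with
  | zero => simp [contractList]
  | succ k ih =>
    rw [List.ofFn_succ, contractList_cons, contractLeft_ιMulti_succ, contractList_sum,
      Matrix.det_succ_row_zero, map_sum]
    refine Finset.sum_congr rfl fun j _ => ?_
    rw [contractList_smul, ih, Algebra.smul_def, ← map_mul]
    rfl

theorem contractList_ιMulti_of_lt {k n : ℕ} (h : k < n) (d : Fin n → Module.Dual R M)
    (v : Fin k → M) : contractList (List.ofFn d) (ιMulti R k v) = 0 := by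
  induction k generalizing n with
  | zero =>
    obtain ⟨n, rfl⟩ := Nat.exists_eq_succ_of_ne_zero h.ne'
    have h0 : ∀ l : List (Module.Dual R M), contractList l (0 : ExteriorAlgebra R M) = 0 :=
      fun l => by simpa using contractList_smul l 0 (0 : ExteriorAlgebra R M)
    rw [List.ofFn_succ, contractList_cons, ιMulti_zero_apply, contractLeft_one, h0]
  | succ k ih =>
    obtain ⟨n, rfl⟩ := Nat.exists_eq_succ_of_ne_zero (Nat.ne_of_gt (Nat.zero_lt_of_lt h))
    rw [List.ofFn_succ, contractList_cons, contractLeft_ιMulti_succ, contractList_sum]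
    refine Finset.sum_eq_zero fun j _ => ?_
    rw [contractList_smul, ih (by omega), smul_zero]

/-! ### The Wick functional of an alternating form -/

/-- The linear functional on the exterior algebra attached to an alternating bilinear form `B`: its
value on `v_1 ∧ ⋯ ∧ v_n` is the Pfaffian of the matrix `B v_i v_j`. It is the scalar part of the
change of form by `-B` from the exterior algebra to itself. -/
noncomputable def wick (B : LinearMap.BilinForm R M) (hB : B.IsAlt) :
    ExteriorAlgebra R M →ₗ[R] R :=
  algebraMapInv.toLinearMap ∘ₗ
    CliffordAlgebra.changeForm (B := -B) (Q := (0 : QuadraticForm R M)) (Q' := 0) (by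
      ext v
      simp [hB.self_eq_zero v])

variable {B : LinearMap.BilinForm R M} (hB : B.IsAlt)

theorem wick_one : wick B hB 1 = 1 := by
  simp [wick]

theorem wick_ι_mul (v : M) (z : ExteriorAlgebra R M) :
    wick B hB (ι R v * z) = wick B hB (contractLeft (B v) z) := by
  simp only [wick, LinearMap.comp_apply, CliffordAlgebra.changeForm_contractLeft, ι,
    CliffordAlgebra.changeForm_ι_mul]
  have : algebraMapInv (CliffordAlgebra.ι (0 : QuadraticForm R M) v) = (0 : R) := by
    simp [algebraMapInv]
  simp [this]

/-- The two rules `wick_one` and `wick_ι_mul` characterize the functional. -/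
theorem eq_smul_wick (P : ExteriorAlgebra R M →ₗ[R] R)
    (hP : ∀ v z, P (ι R v * z) = P (contractLeft (B v) z)) : P = P 1 • wick B hB := by
  have key : ∀ k (v : Fin k → M), P (ιMulti R k v) = P 1 * wick B hB (ιMulti R k v) := by
    intro k
    induction k using Nat.strong_induction_on with
    | _ k ih =>
      intro v
      match k, v, ih with
      | 0, v, ih => simp [wick_one]
      | 1, v, ih =>
        have h1 := hP (v 0) 1
        have h2 := wick_ι_mul hB (v 0) 1
        simp only [mul_one, contractLeft_one, map_zero] at h1 h2
        simp [h1, h2]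
      | k + 2, v, ih =>
        rw [ιMulti_succ_apply, hP, wick_ι_mul, contractLeft_ιMulti_succ, map_sum, map_sum,
          Finset.mul_sum]
        refine Finset.sum_congr rfl fun j _ => ?_
        rw [map_smul, map_smul, ih k (by omega), smul_eq_mul, smul_eq_mul, mul_left_comm]
  have key' : ∀ l : List M, P (l.map (ι R)).prod = P 1 * wick B hB (l.map (ι R)).prod := by
    intro l
    have := key l.length l.get
    simpa [ιMulti_apply, List.ofFn_getElem_eq_map] using this
  have key'' : ∀ (z : ExteriorAlgebra R M) (l : List M),
      P ((l.map (ι R)).prod * z) = P 1 * wick B hB ((l.map (ι R)).prod * z) := by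
    intro z
    induction z using CliffordAlgebra.left_induction with
    | algebraMap r =>
      intro l
      rw [← Algebra.commutes, ← Algebra.smul_def, map_smul, map_smul, key', smul_eq_mul,
        smul_eq_mul, mul_left_comm]
    | add x y hx hy => intro l; rw [mul_add, map_add, map_add, hx, hy, mul_add]
    | ι_mul x v hx =>
      intro l
      have := hx (l ++ [v])
      simpa [mul_assoc] using this
  refine LinearMap.ext fun z => ?_
  simpa using key'' z []

/-- The Schur complement formula. The product of the even family `e` of vectors splits off when
every vector `w` is replaced by its component `h w` orthogonal to the family. -/
theorem wick_list_prod_mul {l : List M} (hl : Even l.length) (h : M →ₗ[R] M)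
    (horth : ∀ v ∈ l, ∀ w, B (h w) v = 0) (hspan : ∀ w, w - h w ∈ Submodule.span R {v | v ∈ l})
    (hh : (B.compl₁₂ h h).IsAlt) (z : ExteriorAlgebra R M) :
    wick B hB ((l.map (ι R)).prod * z) =
      wick B hB (l.map (ι R)).prod * wick (B.compl₁₂ h h) hh z := by
  set E := (l.map (ι R)).prod with hE
  have hcomm : ∀ u, E * ι R u = ι R u * E := fun u => by
    rw [hE, list_prod_mul_ι, hl.neg_one_pow, one_smul]
  -- a vector of the family kills the product
  have hkill : ∀ u ∈ Submodule.span R {v | v ∈ l}, E * ι R u = 0 := by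
    intro u hu
    induction hu using Submodule.span_induction with
    | mem u hu =>
      rw [hcomm, hE]
      clear * - hu
      induction l with
      | nil => simp at hu
      | cons v l ih =>
        rw [List.map_cons, List.prod_cons, ← mul_assoc]
        rcases List.mem_cons.1 hu with rfl | hu
        · rw [ι_sq_zero, zero_mul]
        · rw [ι_mul_ι_swap, neg_mul, mul_assoc, ih hu, mul_zero, neg_zero]
    | zero => simp
    | add x y _ _ hx hy => rw [map_add, mul_add, hx, hy, add_zero]
    | smul r x _ hx => rw [map_smul, mul_smul_comm, hx, smul_zero]
  have hproj : ∀ u, E * ι R u = E * ι R (h u) := fun u => by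
    rw [← sub_eq_zero, ← mul_sub, ← map_sub, hkill _ (hspan u)]
  have hmap : ∀ z, E * z = E * map h z := by
    intro z
    induction z using CliffordAlgebra.left_induction with
    | algebraMap r => rw [AlgHom.commutes]
    | add x y hx hy => rw [mul_add, hx, hy, map_add, mul_add]
    | ι_mul x v hx =>
      change E * (ι R v * x) = E * map h (ι R v * x)
      rw [map_mul, map_apply_ι, ← mul_assoc, hproj, hcomm, mul_assoc, hx, ← mul_assoc, ← mul_assoc,
        hcomm]
  have := eq_smul_wick hh (wick B hB ∘ₗ LinearMap.mulLeft R E ∘ₗ (map h).toLinearMap) fun v z => by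
    simp only [LinearMap.comp_apply, AlgHom.toLinearMap_apply, map_mul, map_apply_ι,
      LinearMap.mulLeft_apply]
    rw [← mul_assoc, hcomm, mul_assoc, wick_ι_mul, hE,
      contractLeft_list_prod_mul (fun w hw => horth w hw v), hl.neg_one_pow, one_smul,
      contractLeft_map]
    rfl
  have h := LinearMap.congr_fun this z
  simpa [← hmap] using h

end ExteriorAlgebra

/-! ### The Wick functional as a Pfaffian -/

namespace ExteriorAlgebra

open CliffordAlgebra (contractLeft)

variable {V : Type*} [AddCommGroup V] [Module ℝ V] {B : LinearMap.BilinForm ℝ V} (hB : B.IsAlt)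

theorem wick_ιMulti_add_two (k : ℕ) (v : Fin (k + 2) → V) :
    wick B hB (ιMulti ℝ (k + 2) v) =
      ∑ j : Fin (k + 1), (-1 : ℝ) ^ (j : ℕ) * B (v 0) (v j.succ) *
        wick B hB (ιMulti ℝ k fun i => v (j.succAbove i).succ) := by
  rw [ιMulti_succ_apply, wick_ι_mul, contractLeft_ιMulti_succ, map_sum]
  refine Finset.sum_congr rfl fun j _ => ?_
  rw [map_smul, smul_eq_mul]
  rfl

/-- Averaging the expansion along the first vector over all orderings of the vectors, all partners
of the first vector contribute equally. -/
theorem wick_ιMulti_add_two_eq_sum_perm (k : ℕ) (v : Fin (k + 2) → V) :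
    ((k + 2)! : ℝ) * wick B hB (ιMulti ℝ (k + 2) v) =
      (k + 1) * ∑ σ : Equiv.Perm (Fin (k + 2)), ((Equiv.Perm.sign σ : ℤ) : ℝ) *
        (B (v (σ 0)) (v (σ 1)) * wick B hB (ιMulti ℝ k fun i => v (σ i.succ.succ))) := by
  have h1 : ((k + 2)! : ℝ) * wick B hB (ιMulti ℝ (k + 2) v) =
      ∑ σ : Equiv.Perm (Fin (k + 2)), ((Equiv.Perm.sign σ : ℤ) : ℝ) *
        wick B hB (ιMulti ℝ (k + 2) (v ∘ σ)) := by
    have : ∀ σ : Equiv.Perm (Fin (k + 2)), ((Equiv.Perm.sign σ : ℤ) : ℝ) *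
        wick B hB (ιMulti ℝ (k + 2) (v ∘ σ)) = wick B hB (ιMulti ℝ (k + 2) v) := fun σ => by
      rw [AlternatingMap.map_perm]
      rcases Int.units_eq_one_or (Equiv.Perm.sign σ) with h | h <;> simp [h]
    rw [Finset.sum_congr rfl fun σ _ => this σ, Finset.sum_const, Finset.card_univ,
      Fintype.card_perm, Fintype.card_fin, nsmul_eq_mul]
  rw [h1]
  simp_rw [wick_ιMulti_add_two, Finset.mul_sum]
  rw [Finset.sum_comm]
  have h2 : ∀ j : Fin (k + 1), ∑ σ : Equiv.Perm (Fin (k + 2)), ((Equiv.Perm.sign σ : ℤ) : ℝ) *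
      ((-1 : ℝ) ^ (j : ℕ) * B ((v ∘ σ) 0) ((v ∘ σ) j.succ) *
        wick B hB (ιMulti ℝ k fun i => (v ∘ σ) (j.succAbove i).succ)) =
      ∑ σ : Equiv.Perm (Fin (k + 2)), ((Equiv.Perm.sign σ : ℤ) : ℝ) *
        (B (v (σ 0)) (v (σ 1)) * wick B hB (ιMulti ℝ k fun i => v (σ i.succ.succ))) := by
    intro j
    -- the cycle that moves the partner `j + 1` to position `1` and keeps the other vectors in order
    set c : Equiv.Perm (Fin (k + 2)) := Equiv.Perm.decomposeFin.symm (0, j.cycleRange.symm) with hc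
    have c0 : c 0 = 0 := by simp [hc]
    have cs : ∀ i : Fin (k + 1), c i.succ = (j.cycleRange.symm i).succ := fun i => by
      rw [hc, Equiv.Perm.decomposeFin_symm_apply_succ]; simp
    have c1 : c 1 = j.succ := by
      have := cs 0
      rwa [Fin.cycleRange_symm_zero] at this
    have c2 : ∀ i : Fin k, c i.succ.succ = (j.succAbove i).succ := fun i => by
      rw [cs, Fin.cycleRange_symm_succ]
    have csign : ((Equiv.Perm.sign c : ℤ) : ℝ) = (-1) ^ (j : ℕ) := by
      rw [hc, Equiv.Perm.decomposeFin.symm_sign]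
      simp [Equiv.Perm.sign_symm]
    rw [← Equiv.sum_comp (Equiv.mulRight c) (fun σ : Equiv.Perm (Fin (k + 2)) =>
      ((Equiv.Perm.sign σ : ℤ) : ℝ) *
        (B (v (σ 0)) (v (σ 1)) * wick B hB (ιMulti ℝ k fun i => v (σ i.succ.succ))))]
    refine Finset.sum_congr rfl fun σ _ => ?_
    simp only [Equiv.coe_mulRight, Equiv.Perm.coe_mul, Function.comp_apply, c0, c1, c2,
      Equiv.Perm.sign_mul, Units.val_mul, Int.cast_mul, csign]
    ring
  rw [Finset.sum_congr rfl fun j _ => h2 j]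
  simp [Finset.mul_sum]

theorem wick_ιMulti_eq_pfaffian (n : ℕ) (v : Fin (2 * n) → V) :
    wick B hB (ιMulti ℝ (2 * n) v) = pfaffian (Matrix.of fun i j => B (v i) (v j)) := by
  induction n with
  | zero =>
    have : ιMulti ℝ (2 * 0) v = 1 := ιMulti_zero_apply v
    rw [this, wick_one]
    simp [pfaffian]
  | succ n ih =>
    have h1 := wick_ιMulti_add_two_eq_sum_perm hB (2 * n) v
    have hre : ∀ π : Equiv.Perm (Fin (2 * n)),
        ∑ σ : Equiv.Perm (Fin (2 * n + 2)), ((Equiv.Perm.sign σ : ℤ) : ℝ) *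
          (((Equiv.Perm.sign π : ℤ) : ℝ) * (B (v (σ 0)) (v (σ 1)) *
            ∏ i : Fin n, B (v (σ (π ⟨2 * i, by omega⟩).succ.succ))
              (v (σ (π ⟨2 * i + 1, by omega⟩).succ.succ)))) =
        ∑ σ : Equiv.Perm (Fin (2 * n + 2)), ((Equiv.Perm.sign σ : ℤ) : ℝ) *
          ∏ i : Fin (n + 1), B (v (σ ⟨2 * i, by omega⟩)) (v (σ ⟨2 * i + 1, by omega⟩)) := by
      intro π
      -- `π` extended by the identity on the first two positions
      set c : Equiv.Perm (Fin (2 * n + 2)) :=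
        Equiv.Perm.decomposeFin.symm (0, Equiv.Perm.decomposeFin.symm (0, π)) with hc
      have c0 : c 0 = 0 := by simp [hc]
      have c1 : c 1 = 1 := by simp [hc]
      have c2 : ∀ i : Fin (2 * n), c i.succ.succ = (π i).succ.succ := fun i => by
        rw [hc, Equiv.Perm.decomposeFin_symm_apply_succ, Equiv.Perm.decomposeFin_symm_apply_succ]
        simp
      have csign : Equiv.Perm.sign c = Equiv.Perm.sign π := by
        rw [hc, Equiv.Perm.decomposeFin.symm_sign, Equiv.Perm.decomposeFin.symm_sign]
        simp
      rw [← Equiv.sum_comp (Equiv.mulRight c) (fun σ : Equiv.Perm (Fin (2 * n + 2)) =>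
        ((Equiv.Perm.sign σ : ℤ) : ℝ) *
          ∏ i : Fin (n + 1), B (v (σ ⟨2 * i, by omega⟩)) (v (σ ⟨2 * i + 1, by omega⟩)))]
      refine Finset.sum_congr rfl fun σ _ => ?_
      simp only [Equiv.coe_mulRight, Equiv.Perm.coe_mul, Function.comp_apply,
        Equiv.Perm.sign_mul, Units.val_mul, Int.cast_mul, csign, Fin.prod_univ_succ]
      have e0 : c ⟨2 * ((0 : Fin (n + 1)) : ℕ), by simp⟩ = 0 := c0
      have e1 : c ⟨2 * ((0 : Fin (n + 1)) : ℕ) + 1, by simp⟩ = 1 := c1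
      have e2 : ∀ i : Fin n, c ⟨2 * (i.succ : ℕ), by rw [Fin.val_succ]; omega⟩ =
          (π ⟨2 * i, by omega⟩).succ.succ := fun i => c2 ⟨2 * i, by omega⟩
      have e3 : ∀ i : Fin n, c ⟨2 * (i.succ : ℕ) + 1, by rw [Fin.val_succ]; omega⟩ =
          (π ⟨2 * i + 1, by omega⟩).succ.succ := fun i => c2 ⟨2 * i + 1, by omega⟩
      rw [e0, e1]
      simp only [e2, e3]
      ring
    simp only [ih, pfaffian, Matrix.of_apply] at h1
    have hfac : ((2 * n + 2)! : ℝ) = (2 * n + 2) * (2 * n + 1) * (2 * n)! := by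
      rw [Nat.factorial_succ, Nat.factorial_succ]; push_cast; ring
    have hS : ∑ σ : Equiv.Perm (Fin (2 * n + 2)), ((Equiv.Perm.sign σ : ℤ) : ℝ) *
          (B (v (σ 0)) (v (σ 1)) * (1 / (2 ^ n * (n ! : ℝ)) *
            ∑ π : Equiv.Perm (Fin (2 * n)), ((Equiv.Perm.sign π : ℤ) : ℝ) *
              ∏ i : Fin n, B (v (σ (π ⟨2 * i, by omega⟩).succ.succ))
                (v (σ (π ⟨2 * i + 1, by omega⟩).succ.succ)))) =
        1 / (2 ^ n * (n ! : ℝ)) * ((2 * n)! *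
          ∑ σ : Equiv.Perm (Fin (2 * n + 2)), ((Equiv.Perm.sign σ : ℤ) : ℝ) *
          ∏ i : Fin (n + 1), B (v (σ ⟨2 * i, by omega⟩)) (v (σ ⟨2 * i + 1, by omega⟩))) := by
      have := Finset.sum_congr rfl fun (π : Equiv.Perm (Fin (2 * n))) (_ : π ∈ Finset.univ) => hre π
      rw [Finset.sum_const, Finset.card_univ, Fintype.card_perm, Fintype.card_fin, nsmul_eq_mul]
        at this
      rw [← this, Finset.sum_comm, Finset.mul_sum]
      refine Finset.sum_congr rfl fun σ _ => ?_
      simp only [Finset.mul_sum]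
      refine Finset.sum_congr rfl fun π _ => ?_
      ring
    rw [hS, hfac] at h1
    simp only [pfaffian, Matrix.of_apply]
    have hn : (0 : ℝ) < (n ! : ℝ) := by positivity
    have h2n : (0 : ℝ) < ((2 * n)! : ℝ) := by positivity
    have hpos : (0 : ℝ) < (2 * n + 2) * (2 * n + 1) * (2 * n)! := by positivity
    refine mul_left_cancel₀ hpos.ne' (h1.trans ?_)
    rw [Nat.factorial_succ]
    push_cast
    field_simp
    ring_nf
    rfl

end ExteriorAlgebra

/-! ### Schur's Pfaffian identity -/

/-- The bilinear form on the free module over `I` with Gram matrix `b` in the standard basis. -/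
noncomputable def gramForm {I : Type*} (b : I → I → ℝ) : LinearMap.BilinForm ℝ (I →₀ ℝ) :=
  Finsupp.linearCombination ℝ fun p => Finsupp.linearCombination ℝ (b p)

theorem gramForm_single {I : Type*} (b : I → I → ℝ) (p q : I) :
    gramForm b (Finsupp.single p 1) (Finsupp.single q 1) = b p q := by
  simp [gramForm]

theorem gramForm_isAlt {I : Type*} {b : I → I → ℝ} (hb : ∀ p q, b p q = -b q p) :
    (gramForm b).IsAlt := by
  have h : gramForm b = -(gramForm b).flip := by
    ext p q
    simpa [gramForm] using hb p q
  intro v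
  have : gramForm b v v = -gramForm b v v := LinearMap.congr_fun (LinearMap.congr_fun h v) v
  linarith

theorem LinearMap.BilinForm.IsAlt.compl₁₂ {V W : Type*} [AddCommGroup V] [Module ℝ V]
    [AddCommGroup W] [Module ℝ W] {B : LinearMap.BilinForm ℝ V} (hB : B.IsAlt) (g : W →ₗ[ℝ] V) :
    LinearMap.BilinForm.IsAlt (LinearMap.compl₁₂ B g g) := fun v => hB.self_eq_zero (g v)

open ExteriorAlgebra in
theorem pfaffian_mul_mul {n : ℕ} {A : Fin (2 * n) → Fin (2 * n) → ℝ}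
    (hA : ∀ i j, A i j = -A j i) (r : Fin (2 * n) → ℝ) :
    pfaffian (Matrix.of fun i j => r i * A i j * r j) = (∏ i, r i) * pfaffian (Matrix.of A) := by
  have hB := gramForm_isAlt hA
  have h1 := wick_ιMulti_eq_pfaffian hB n fun i => r i • Finsupp.single i 1
  have h2 := wick_ιMulti_eq_pfaffian hB n fun i => Finsupp.single i 1
  rw [AlternatingMap.map_smul_univ, map_smul, h2, smul_eq_mul] at h1
  simp only [map_smul, LinearMap.smul_apply, gramForm_single, smul_eq_mul] at h1
  have e : (Matrix.of fun i j => A i j) = Matrix.of A := rfl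
  rw [← e, h1]
  congr 1
  ext i j
  simp only [Matrix.of_apply]
  ring

/-- The elimination step of Schur's Pfaffian: the Schur complement of the first two rows is the
matrix of the other points, rescaled. -/
theorem buresEps_schur_complement {a b p q : ℝ} (ha : 0 < a) (hb : 0 < b) (hp : 0 < p) (hq : 0 < q)
    (hab : a ≠ b) :
    buresEps q p - (buresEps b a)⁻¹ * (buresEps b p * buresEps q a) +
        (buresEps b a)⁻¹ * (buresEps a p * buresEps q b) =
      buresEps p a * buresEps p b * buresEps q p * (buresEps q a * buresEps q b) := by
  have h : b - a ≠ 0 := sub_ne_zero.2 hab.symm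
  unfold buresEps
  field_simp
  ring

theorem Fin.prod_prod_Ioi_succ {n : ℕ} (f : Fin (n + 1) → Fin (n + 1) → ℝ) :
    ∏ i, ∏ j ∈ Finset.Ioi i, f i j =
      (∏ j : Fin n, f 0 j.succ) * ∏ i : Fin n, ∏ j ∈ Finset.Ioi i, f i.succ j.succ := by
  rw [Fin.prod_univ_succ, Fin.prod_Ioi_zero]
  simp_rw [Fin.prod_Ioi_succ]

open ExteriorAlgebra in
/-- Schur's Pfaffian identity, by elimination of two points at a time. -/
theorem pfaffian_buresEps (n : ℕ) (x : Fin (2 * n) → ℝ) (hx : ∀ i, 0 < x i) :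
    pfaffian (Matrix.of fun i j => buresEps (x j) (x i)) =
      ∏ i, ∏ j ∈ Finset.Ioi i, buresEps (x j) (x i) := by
  induction n with
  | zero => simp [pfaffian]
  | succ n ih =>
    change Fin (2 * n + 2) → ℝ at x
    change _ = ∏ i : Fin (2 * n + 2), ∏ j ∈ Finset.Ioi i, buresEps (x j) (x i)
    have hskew : ∀ a b : ℝ, buresEps a b = -buresEps b a := fun a b => by
      rw [buresEps, buresEps, ← neg_div, neg_sub, add_comm]
    rw [Fin.prod_prod_Ioi_succ, Fin.prod_prod_Ioi_succ]
    set b : Fin (2 * n + 2) → Fin (2 * n + 2) → ℝ := fun i j => buresEps (x j) (x i) with hb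
    have hB : (gramForm b).IsAlt := gramForm_isAlt fun i j => hskew _ _
    set e : Fin (2 * n + 2) → (Fin (2 * n + 2) →₀ ℝ) := fun i => Finsupp.single i 1 with he
    have hBe : ∀ i j, gramForm b (e i) (e j) = buresEps (x j) (x i) := fun i j =>
      gramForm_single b i j
    have hw : pfaffian (n := n + 1) (Matrix.of fun i j => buresEps (x j) (x i)) =
        wick _ hB (([e 0, e 1].map (ι ℝ)).prod * ιMulti ℝ (2 * n) fun i => e i.succ.succ) := by
      have := wick_ιMulti_eq_pfaffian hB (n + 1) e
      simp only [hBe] at this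
      rw [← this]
      have h2 : ιMulti ℝ (2 * (n + 1)) e =
        ι ℝ (e 0) * (ι ℝ (e 1) * ιMulti ℝ (2 * n) fun i => e i.succ.succ) :=
        (ιMulti_succ_apply (R := ℝ) (n := 2 * n + 1) e).trans
          (congrArg _ (ιMulti_succ_apply (R := ℝ) (n := 2 * n) _))
      rw [h2]
      simp [mul_assoc]
    rw [hw]
    by_cases h01 : x 0 = x 1
    · -- two equal points
      have h0 : buresEps (x 1) (x 0) = 0 := by rw [h01]; simp [buresEps]
      have hr : gramForm b (e 0) = gramForm b (e 1) := by
        ext j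
        simp [he, hb, gramForm, h01]
      have : (∏ j : Fin (2 * n + 1), buresEps (x j.succ) (x 0)) = 0 :=
        Finset.prod_eq_zero (Finset.mem_univ 0) h0
      rw [this, zero_mul]
      simp only [List.map_cons, List.map_nil, List.prod_cons, List.prod_nil, mul_one]
      rw [mul_assoc, wick_ι_mul, hr, ← wick_ι_mul, ← mul_assoc, ι_sq_zero, zero_mul, map_zero]
    · set a := buresEps (x 1) (x 0) with ha
      have ha0 : a ≠ 0 := by
        have := hx 0
        have := hx 1
        exact div_ne_zero (sub_ne_zero.2 (Ne.symm h01)) (by positivity)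
      have B01 : gramForm b (e 0) (e 1) = a := hBe 0 1
      have B10 : gramForm b (e 1) (e 0) = -a := (hBe 1 0).trans (hskew _ _)
      set h : (Fin (2 * n + 2) →₀ ℝ) →ₗ[ℝ] (Fin (2 * n + 2) →₀ ℝ) := LinearMap.id -
        a⁻¹ • ((gramForm b).flip (e 1)).smulRight (e 0) +
        a⁻¹ • ((gramForm b).flip (e 0)).smulRight (e 1) with hh
      have happ : ∀ w, h w = w - (a⁻¹ * gramForm b w (e 1)) • e 0 +
          (a⁻¹ * gramForm b w (e 0)) • e 1 := fun w => by
        simp [hh, smul_smul]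
      have horth0 : ∀ w, gramForm b (h w) (e 0) = 0 := fun w => by
        rw [happ]
        simp only [map_add, map_sub, map_smul, LinearMap.add_apply, LinearMap.sub_apply,
          LinearMap.smul_apply, hB.self_eq_zero, B10, smul_eq_mul]
        field_simp
        ring
      have horth1 : ∀ w, gramForm b (h w) (e 1) = 0 := fun w => by
        rw [happ]
        simp only [map_add, map_sub, map_smul, LinearMap.add_apply, LinearMap.sub_apply,
          LinearMap.smul_apply, hB.self_eq_zero, B01, smul_eq_mul]
        field_simp
        ring
      rw [wick_list_prod_mul hB (l := [e 0, e 1]) (by simp) h (by simp [horth0, horth1]) (by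
          intro w
          rw [happ, show w - (w - (a⁻¹ * gramForm b w (e 1)) • e 0 +
            (a⁻¹ * gramForm b w (e 0)) • e 1) = (a⁻¹ * gramForm b w (e 1)) • e 0 -
            (a⁻¹ * gramForm b w (e 0)) • e 1 by abel]
          exact Submodule.sub_mem _
            (Submodule.smul_mem _ _ (Submodule.subset_span (by simp)))
            (Submodule.smul_mem _ _ (Submodule.subset_span (by simp))))
          (hB.compl₁₂ h), wick_ιMulti_eq_pfaffian]
      have hmat : ∀ i j : Fin (2 * n), (LinearMap.compl₁₂ (gramForm b) h h) (e i.succ.succ)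
          (e j.succ.succ) = buresEps (x i.succ.succ) (x 0) * buresEps (x i.succ.succ) (x 1) *
            buresEps (x j.succ.succ) (x i.succ.succ) *
            (buresEps (x j.succ.succ) (x 0) * buresEps (x j.succ.succ) (x 1)) := by
        intro i j
        rw [LinearMap.compl₁₂_apply, happ (e j.succ.succ)]
        simp only [map_add, map_sub, map_smul, horth0, horth1, smul_zero, sub_zero, add_zero]
        rw [happ]
        simp only [map_add, map_sub, map_smul, LinearMap.add_apply, LinearMap.sub_apply,
          LinearMap.smul_apply, hBe, smul_eq_mul]
        rw [← buresEps_schur_complement (hx 0) (hx 1) (hx i.succ.succ) (hx j.succ.succ) h01, ← ha]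
        ring
      simp only [hmat]
      have hE : wick _ hB (([e 0, e 1].map (ι ℝ)).prod) = a := by
        simp [wick_ι_mul, B01, Algebra.algebraMap_eq_smul_one, wick_one]
      have := pfaffian_mul_mul (n := n)
        (A := fun i j => buresEps (x j.succ.succ) (x i.succ.succ))
        (fun i j => hskew _ _)
        (fun i => buresEps (x i.succ.succ) (x 0) * buresEps (x i.succ.succ) (x 1))
      rw [hE, this, ih (fun i => x i.succ.succ) fun i => hx _, Fin.prod_univ_succ,
        Finset.prod_mul_distrib]
      have : (Fin.succ (0 : Fin (2 * n + 1))) = 1 := rfl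
      rw [this, ← ha]
      ring

/-! ### Bordered Pfaffians -/

/-- The data of a Pfaffian ensemble, integrals left aside: functions `phi_i`, a skew-symmetric
function `eps`, functions `psi_i` (the images `eps · phi_i`), and a skew-symmetric matrix `M` (the
moments). -/
structure PfaffianSystem (N : ℕ) (Y : Type*) where
  moment : Matrix (Fin N) (Fin N) ℝ
  phi : Fin N → Y → ℝ
  psi : Fin N → Y → ℝ
  eps : Y → Y → ℝ
  moment_skew : ∀ i j, moment i j = -moment j i
  eps_skew : ∀ x y, eps x y = -eps y x

namespace PfaffianSystem

open ExteriorAlgebra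
open CliffordAlgebra (contractLeft contractLeft_ι_mul contractLeft_comm)

variable {N : ℕ} {Y : Type*} (S : PfaffianSystem N Y)

/-- The Gram matrix of the vectors `e_i` (one for each function `phi_i`) and `f_y`, `g_y` (two for
each point `y`). -/
def gram : Fin N ⊕ Y ⊕ Y → Fin N ⊕ Y ⊕ Y → ℝ
  | .inl i, .inl j => -S.moment i j
  | .inl i, .inr (.inl y) => S.phi i y
  | .inl i, .inr (.inr y) => S.psi i y
  | .inr (.inl y), .inl i => -S.phi i y
  | .inr (.inr y), .inl i => -S.psi i y
  | .inr (.inl _), .inr (.inl _) => 0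
  | .inr (.inl _), .inr (.inr _) => 0
  | .inr (.inr _), .inr (.inl _) => 0
  | .inr (.inr x), .inr (.inr y) => -S.eps x y

theorem gram_skew (p q : Fin N ⊕ Y ⊕ Y) : S.gram p q = -S.gram q p := by
  rcases p with i | x | x <;> rcases q with j | y | y <;> simp only [gram, neg_neg, neg_zero]
  · rw [S.moment_skew, neg_neg]
  · rw [S.eps_skew, neg_neg]

/-- The alternating form with Gram matrix `gram`. -/
noncomputable abbrev form : LinearMap.BilinForm ℝ (Fin N ⊕ Y ⊕ Y →₀ ℝ) := gramForm S.gram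

theorem form_isAlt : S.form.IsAlt := gramForm_isAlt S.gram_skew

theorem form_swap (u v : Fin N ⊕ Y ⊕ Y →₀ ℝ) : S.form u v = -S.form v u :=
  (LinearMap.BilinForm.IsAlt.neg_eq S.form_isAlt v u).symm

/-- The Wick functional of the form of the system. -/
noncomputable abbrev wickForm : ExteriorAlgebra ℝ (Fin N ⊕ Y ⊕ Y →₀ ℝ) →ₗ[ℝ] ℝ :=
  wick S.form S.form_isAlt

variable (N Y) in
/-- The basis vector `e_i`. -/
noncomputable def vecE (i : Fin N) : Fin N ⊕ Y ⊕ Y →₀ ℝ := Finsupp.single (.inl i) 1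

variable (N) in
/-- The basis vector `f_y`. -/
noncomputable def vecF (y : Y) : Fin N ⊕ Y ⊕ Y →₀ ℝ := Finsupp.single (.inr (.inl y)) 1

variable (N) in
/-- The basis vector `g_y`. -/
noncomputable def vecG (y : Y) : Fin N ⊕ Y ⊕ Y →₀ ℝ := Finsupp.single (.inr (.inr y)) 1

variable (N Y) in
/-- The product `e_0 ∧ ⋯ ∧ e_{N-1}`. -/
noncomputable def prodE : ExteriorAlgebra ℝ (Fin N ⊕ Y ⊕ Y →₀ ℝ) := ιMulti ℝ N (vecE N Y)

variable (N) in
/-- The product of the pairs `f_y ∧ g_y` over a list of points. -/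
noncomputable def pairProd (l : List Y) : ExteriorAlgebra ℝ (Fin N ⊕ Y ⊕ Y →₀ ℝ) :=
  (l.map fun y => ι ℝ (vecF N y) * ι ℝ (vecG N y)).prod

/-- The bordered Pfaffian of a list of points: the Pfaffian of the Gram matrix of the `e_i` and of
the `f_y`, `g_y` of the points. -/
noncomputable def bordered (l : List Y) : ℝ := S.wickForm (pairProd N l * prodE N Y)

theorem prodE_eq : prodE N Y = ((List.ofFn (vecE N Y)).map (ι ℝ)).prod := by
  rw [prodE, ιMulti_apply, List.map_ofFn]
  rfl

theorem pairProd_cons (y : Y) (l : List Y) :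
    pairProd N (y :: l) = ι ℝ (vecF N y) * ι ℝ (vecG N y) * pairProd N l := by
  simp [pairProd]

theorem commute_pair_ι (y : Y) (u : Fin N ⊕ Y ⊕ Y →₀ ℝ) :
    Commute (ι ℝ (vecF N y) * ι ℝ (vecG N y)) (ι ℝ u) := by
  rw [Commute, SemiconjBy, mul_assoc, ι_mul_ι_swap _ u, mul_neg, ← mul_assoc, ι_mul_ι_swap _ u,
    neg_mul, neg_neg, mul_assoc]

theorem commute_pair_prod (y : Y) (l : List (Fin N ⊕ Y ⊕ Y →₀ ℝ)) :
    Commute (ι ℝ (vecF N y) * ι ℝ (vecG N y)) (l.map (ι ℝ)).prod :=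
  Commute.list_prod_right _ _ fun z hz => by
    obtain ⟨u, -, rfl⟩ := List.mem_map.1 hz
    exact commute_pair_ι y u

theorem commute_pairProd_prod (l' : List Y) (l : List (Fin N ⊕ Y ⊕ Y →₀ ℝ)) :
    Commute (pairProd N l') (l.map (ι ℝ)).prod :=
  Commute.list_prod_left _ _ fun z hz => by
    obtain ⟨u, -, rfl⟩ := List.mem_map.1 hz
    exact commute_pair_prod u l

theorem pairProd_perm {l l' : List Y} (h : l.Perm l') : pairProd N l = pairProd N l' := by
  induction h with
  | nil => rfl
  | cons y _ ih => rw [pairProd_cons, pairProd_cons, ih]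
  | swap x y l =>
    have := (commute_pair_prod (N := N) x [vecF N y, vecG N y]).eq
    simp only [List.map_cons, List.map_nil, List.prod_cons, List.prod_nil, mul_one] at this
    simp only [pairProd_cons]
    rw [← mul_assoc, ← this, mul_assoc]
  | trans _ _ ih ih' => rw [ih, ih']

theorem bordered_perm {l l' : List Y} (h : l.Perm l') : S.bordered l = S.bordered l' := by
  rw [bordered, bordered, pairProd_perm h]

/-! ### Contracting the vectors `f_y` -/

theorem form_vecF_vecE (y : Y) (i : Fin N) : S.form (vecF N y) (vecE N Y i) = -S.phi i y :=
  gramForm_single _ _ _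

theorem form_vecF_vecF (x y : Y) : S.form (vecF N x) (vecF N y) = 0 := gramForm_single _ _ _

theorem form_vecF_vecG (x y : Y) : S.form (vecF N x) (vecG N y) = 0 := gramForm_single _ _ _

theorem form_vecG_vecG (x y : Y) : S.form (vecG N x) (vecG N y) = -S.eps x y :=
  gramForm_single _ _ _

theorem contractLeft_pairProd_mul (x : Y) (l : List Y)
    (z : ExteriorAlgebra ℝ (Fin N ⊕ Y ⊕ Y →₀ ℝ)) :
    contractLeft (S.form (vecF N x)) (pairProd N l * z) =
      pairProd N l * contractLeft (S.form (vecF N x)) z := by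
  induction l with
  | nil => simp [pairProd]
  | cons y l ih =>
    rw [pairProd_cons, mul_assoc, mul_assoc, contractLeft_ι_mul, contractLeft_ι_mul,
      S.form_vecF_vecF, S.form_vecF_vecG, ih]
    simp [mul_assoc]

/-- Every pair `f_y ∧ g_y` can be traded for `g_y` and a contraction with `f_y`, since `f_y` is
orthogonal to all `f` and `g`. The accumulated factors `g` are kept in `l'` for the induction. -/
theorem wickForm_mul_pairProd (l l' : List Y) (z : ExteriorAlgebra ℝ (Fin N ⊕ Y ⊕ Y →₀ ℝ)) :
    S.wickForm (((l'.map (vecG N)).map (ι ℝ)).prod * (pairProd N l * z)) =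
      (-1) ^ l.length * S.wickForm ((((l' ++ l).map (vecG N)).map (ι ℝ)).prod *
        contractList (l.map fun y => S.form (vecF N y)) z) := by
  induction l generalizing l' z with
  | nil => simp [pairProd, contractList]
  | cons y l ih =>
    have h0 : ∀ v ∈ l'.map (vecG N), S.form (vecF N y) v = 0 := by
      intro v hv
      obtain ⟨x, -, rfl⟩ := List.mem_map.1 hv
      exact S.form_vecF_vecG y x
    rw [pairProd_cons, mul_assoc, mul_assoc, ← mul_assoc, list_prod_mul_ι, smul_mul_assoc, map_smul,
      mul_assoc, wickForm, wick_ι_mul, contractLeft_list_prod_mul h0, contractLeft_ι_mul,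
      S.form_vecF_vecG, zero_smul, zero_sub, contractLeft_pairProd_mul, map_smul, smul_smul,
      ← mul_pow, neg_one_mul, neg_neg, one_pow, one_smul, mul_neg, map_neg]
    have := ih (l' ++ [y]) (contractLeft (S.form (vecF N y)) z)
    simp only [List.map_append, List.map_cons, List.map_nil, List.prod_append, List.prod_cons,
      List.prod_nil, mul_one, mul_assoc, List.append_assoc, List.cons_append, List.nil_append]
      at this
    simp only [List.map_append, List.map_cons, List.prod_append, List.prod_cons, mul_assoc,
      List.length_cons, contractList_cons, pow_succ]
    rw [this]
    ring

theorem bordered_eq (l : List Y) : S.bordered l = (-1) ^ l.length *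
    S.wickForm (((l.map (vecG N)).map (ι ℝ)).prod *
      contractList (l.map fun y => S.form (vecF N y)) (prodE N Y)) := by
  simpa [bordered] using S.wickForm_mul_pairProd l [] (prodE N Y)

theorem bordered_of_lt {l : List Y} (h : N < l.length) : S.bordered l = 0 := by
  rw [bordered_eq]
  have := contractList_ιMulti_of_lt h (fun i => S.form (vecF N (l.get i))) (vecE N Y)
  have e : List.ofFn (fun i => S.form (vecF N (l.get i))) = l.map fun y => S.form (vecF N y) := by
    simp [List.ofFn_getElem_eq_map l (fun y => S.form (vecF N y))]
  rw [prodE, ← e, this]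
  simp

/-- For as many points as functions the bordered Pfaffian factors into a determinant and a
Pfaffian. -/
theorem bordered_ofFn {m : ℕ} (S : PfaffianSystem (2 * m) Y) (z : Fin (2 * m) → Y) :
    S.bordered (List.ofFn z) = (Matrix.of fun i j => S.phi j (z i)).det *
      pfaffian (Matrix.of fun i j => S.eps (z j) (z i)) := by
  have hdet : (Matrix.of fun i j => S.form (vecF (2 * m) (z i)) (vecE (2 * m) Y j)).det =
      (Matrix.of fun i j => S.phi j (z i)).det := by
    have : (Matrix.of fun i j => S.form (vecF (2 * m) (z i)) (vecE (2 * m) Y j)) =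
        -(Matrix.of fun i j => S.phi j (z i)) := by
      ext i j
      exact S.form_vecF_vecE _ _
    rw [this, Matrix.det_neg]
    simp
  have hpf : S.wickForm (((List.ofFn z).map (vecG (2 * m))).map (ι ℝ)).prod =
      pfaffian (Matrix.of fun i j => S.eps (z j) (z i)) := by
    have := wick_ιMulti_eq_pfaffian S.form_isAlt m fun i => vecG (2 * m) (z i)
    simp only [form_vecG_vecG] at this
    rw [ιMulti_apply] at this
    rw [List.map_ofFn, List.map_ofFn]
    refine this.trans ?_
    congr 1
    ext i j
    simp only [Matrix.of_apply]
    rw [S.eps_skew, neg_neg]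
  have := contractList_ιMulti (2 * m) (fun i => S.form (vecF (2 * m) (z i))) (vecE (2 * m) Y)
  rw [bordered_eq, List.map_ofFn (f := z) (g := fun y => S.form (vecF (2 * m) y)), prodE]
  simp only [Function.comp_def]
  rw [this, hdet, ← Algebra.commutes, ← Algebra.smul_def, map_smul, hpf]
  simp

/-! ### Expansion along a row -/

/-- The contraction with the coordinate functional of a basis vector. -/
noncomputable def coordContract (p : Fin N ⊕ Y ⊕ Y) (z : ExteriorAlgebra ℝ (Fin N ⊕ Y ⊕ Y →₀ ℝ)) :
    ExteriorAlgebra ℝ (Fin N ⊕ Y ⊕ Y →₀ ℝ) :=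
  contractLeft (Finsupp.lapply p : (Fin N ⊕ Y ⊕ Y →₀ ℝ) →ₗ[ℝ] ℝ) z

/-- An element of the exterior algebra that involves only basis vectors with index in `s`. -/
def SupportedOn (s : Finset (Fin N ⊕ Y ⊕ Y)) (z : ExteriorAlgebra ℝ (Fin N ⊕ Y ⊕ Y →₀ ℝ)) : Prop :=
  ∀ d : Module.Dual ℝ (Fin N ⊕ Y ⊕ Y →₀ ℝ), (∀ p ∈ s, d (Finsupp.single p 1) = 0) →
    contractLeft d z = 0

theorem SupportedOn.coordContract {s : Finset (Fin N ⊕ Y ⊕ Y)}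
    {z : ExteriorAlgebra ℝ (Fin N ⊕ Y ⊕ Y →₀ ℝ)} (h : SupportedOn s z) (p : Fin N ⊕ Y ⊕ Y) :
    SupportedOn s (coordContract p z) := fun d hd => by
  rw [PfaffianSystem.coordContract, contractLeft_comm, h d hd, map_zero, neg_zero]

theorem SupportedOn.contractLeft_eq_sum {s : Finset (Fin N ⊕ Y ⊕ Y)}
    {z : ExteriorAlgebra ℝ (Fin N ⊕ Y ⊕ Y →₀ ℝ)} (h : SupportedOn s z)
    (d : Module.Dual ℝ (Fin N ⊕ Y ⊕ Y →₀ ℝ)) :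
    contractLeft d z = ∑ p ∈ s, d (Finsupp.single p 1) • PfaffianSystem.coordContract p z := by
  classical
  have := h (d - ∑ p ∈ s, d (Finsupp.single p 1) • Finsupp.lapply p) fun q hq => by
    simp [Finsupp.single_apply, hq]
  rw [map_sub, LinearMap.sub_apply, sub_eq_zero] at this
  rw [this, map_sum, LinearMap.sum_apply]
  simp [PfaffianSystem.coordContract]

/-- The signed cofactor of the rows `p` and `q`: the Pfaffian that remains when the basis vectors
`p` and `q` are removed from `z`. -/
noncomputable def cofactor (z : ExteriorAlgebra ℝ (Fin N ⊕ Y ⊕ Y →₀ ℝ)) (p q : Fin N ⊕ Y ⊕ Y) : ℝ :=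
  S.wickForm (coordContract q (coordContract p z))

/-- Expansion along the row of a basis vector that divides `z`. -/
theorem wickForm_eq_sum_cofactor {s : Finset (Fin N ⊕ Y ⊕ Y)}
    {z : ExteriorAlgebra ℝ (Fin N ⊕ Y ⊕ Y →₀ ℝ)} (h : SupportedOn s z) {p : Fin N ⊕ Y ⊕ Y}
    (hp : ι ℝ (Finsupp.single p 1) * z = 0) :
    S.wickForm z = ∑ q ∈ s, S.gram p q * S.cofactor z p q := by
  have hz : z = ι ℝ (Finsupp.single p 1) * coordContract p z := by
    have := contractLeft_ι_mul (Q := 0) (Finsupp.lapply p : (Fin N ⊕ Y ⊕ Y →₀ ℝ) →ₗ[ℝ] ℝ)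
      (Finsupp.single p 1) z
    rw [hp, map_zero, eq_comm, sub_eq_zero, Finsupp.lapply_apply, Finsupp.single_eq_same,
      one_smul] at this
    exact this
  conv_lhs => rw [hz]
  rw [wickForm, wick_ι_mul, (h.coordContract p).contractLeft_eq_sum, map_sum]
  simp only [map_smul, smul_eq_mul, gramForm_single, form]
  rfl

theorem wickForm_contract_contract {s : Finset (Fin N ⊕ Y ⊕ Y)}
    {z : ExteriorAlgebra ℝ (Fin N ⊕ Y ⊕ Y →₀ ℝ)} (h : SupportedOn s z)
    (d d' : Module.Dual ℝ (Fin N ⊕ Y ⊕ Y →₀ ℝ)) :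
    S.wickForm (contractLeft d' (contractLeft d z)) =
      ∑ p ∈ s, d (Finsupp.single p 1) * ∑ q ∈ s, d' (Finsupp.single q 1) * S.cofactor z p q := by
  rw [h.contractLeft_eq_sum, map_sum, map_sum]
  refine Finset.sum_congr rfl fun p _ => ?_
  rw [map_smul, map_smul, smul_eq_mul, (h.coordContract p).contractLeft_eq_sum, map_sum]
  simp only [map_smul, smul_eq_mul]
  rfl

theorem cofactor_swap (z : ExteriorAlgebra ℝ (Fin N ⊕ Y ⊕ Y →₀ ℝ)) (p q : Fin N ⊕ Y ⊕ Y) :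
    S.cofactor z p q = -S.cofactor z q p := by
  rw [cofactor, cofactor, coordContract, coordContract, contractLeft_comm, map_neg]
  rfl

theorem ι_vecE_mul_prodE (i : Fin N) : ι ℝ (vecE N Y i) * prodE N Y = 0 := by
  rw [prodE, ιMulti_apply]
  exact ι_mul_prod_list (vecE N Y) i

theorem ι_vecE_mul (i : Fin N) (l : List Y) :
    ι ℝ (vecE N Y i) * (pairProd N l * prodE N Y) = 0 := by
  have := (commute_pairProd_prod l [vecE N Y i]).eq
  simp only [List.map_cons, List.map_nil, List.prod_cons, List.prod_nil, mul_one] at this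
  rw [← mul_assoc, ← this, mul_assoc, ι_vecE_mul_prodE, mul_zero]

theorem ι_vecF_mul {y : Y} {l : List Y} (hy : y ∈ l)
    (z : ExteriorAlgebra ℝ (Fin N ⊕ Y ⊕ Y →₀ ℝ)) :
    ι ℝ (vecF N y) * (pairProd N l * z) = 0 := by
  induction l with
  | nil => simp at hy
  | cons x l ih =>
    rw [pairProd_cons, mul_assoc,
      ← mul_assoc (ι ℝ (vecF N y)) (ι ℝ (vecF N x) * ι ℝ (vecG N x))]
    rcases List.mem_cons.1 hy with rfl | hy
    · rw [← mul_assoc (ι ℝ (vecF N y)) (ι ℝ (vecF N y)), ι_sq_zero, zero_mul, zero_mul]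
    · rw [← (commute_pair_ι x _).eq, mul_assoc, ih hy, mul_zero]

theorem pairProd_mul_of_not_nodup {l : List Y} (hl : ¬ l.Nodup)
    (z : ExteriorAlgebra ℝ (Fin N ⊕ Y ⊕ Y →₀ ℝ)) : pairProd N l * z = 0 := by
  induction l with
  | nil => simp at hl
  | cons y l ih =>
    rw [pairProd_cons, ι_mul_ι_swap, neg_mul, neg_mul, mul_assoc, mul_assoc]
    by_cases hy : y ∈ l
    · rw [ι_vecF_mul hy, mul_zero, neg_zero]
    · rw [ih fun h => hl (List.nodup_cons.2 ⟨hy, h⟩), mul_zero, mul_zero, neg_zero]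

/-- The indices of the vectors in `pairProd N l * prodE N Y`. -/
noncomputable def support [DecidableEq Y] (N : ℕ) (l : List Y) : Finset (Fin N ⊕ Y ⊕ Y) :=
  Finset.univ.disjSum (l.toFinset.disjSum l.toFinset)

theorem supportedOn_support [DecidableEq Y] (l : List Y) :
    SupportedOn (support N l) (pairProd N l * prodE N Y) := by
  intro d hd
  have hE : contractLeft d (prodE N Y) = 0 := by
    rw [prodE_eq]
    refine contractLeft_list_prod fun v hv => ?_
    obtain ⟨i, rfl⟩ := (List.mem_ofFn' _ _).1 hv
    exact hd _ (by simp [support])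
  have hf : ∀ y ∈ l, d (vecF N y) = 0 := fun y hy => hd _ (by simp [support, hy])
  have hg : ∀ y ∈ l, d (vecG N y) = 0 := fun y hy => hd _ (by simp [support, hy])
  clear hd
  induction l with
  | nil => simpa [pairProd] using hE
  | cons y l ih =>
    rw [pairProd_cons, mul_assoc, mul_assoc, contractLeft_ι_mul, contractLeft_ι_mul,
      hf y (by simp), hg y (by simp), ih (fun x hx => hf x (by simp [hx]))
        (fun x hx => hg x (by simp [hx]))]
    simp

/-- The dependence of the bordered Pfaffian on one of its points, and the same expression with the
products of functions replaced by their integrals. The latter is computed by expanding along the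
rows of all `e_i`, and removing the contribution of the rows of the `f_y`. -/
theorem exists_bordered_cons_eq [DecidableEq Y] (l : List Y) :
    ∃ (c : Fin N → Fin N → ℝ) (d : Fin N → Y → ℝ),
      (∀ y, S.bordered (y :: l) = ∑ i, (∑ j, -(S.phi i y * S.psi j y) * c i j +
        ∑ x ∈ l.toFinset, -(S.phi i y * S.eps y x) * d i x)) ∧
      ((N : ℝ) - l.length) * S.bordered l = ∑ i, (∑ j, -S.moment i j * c i j +
        ∑ x ∈ l.toFinset, S.psi i x * d i x) := by
  set Z := pairProd N l * prodE N Y with hZ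
  have hs := supportedOn_support (N := N) l
  rw [← hZ] at hs
  refine ⟨fun i j => S.cofactor Z (.inl i) (.inl j), fun i x => S.cofactor Z (.inl i) (.inr (.inr x)),
    fun y => ?_, ?_⟩
  · have h1 : S.bordered (y :: l) =
        -S.wickForm (contractLeft (S.form (vecG N y)) (contractLeft (S.form (vecF N y)) Z)) := by
      rw [bordered, pairProd_cons, mul_assoc, mul_assoc, ← hZ, wickForm, wick_ι_mul,
        contractLeft_ι_mul, S.form_vecF_vecG, zero_smul, zero_sub, map_neg, wick_ι_mul]
    rw [h1, S.wickForm_contract_contract hs]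
    simp only [support, Finset.sum_disjSum, vecF, vecG, form, gramForm_single, gram, zero_mul,
      Finset.sum_const_zero, add_zero, zero_add]
    rw [← Finset.sum_neg_distrib]
    refine Finset.sum_congr rfl fun i _ => ?_
    rw [neg_mul, neg_neg, mul_add, Finset.mul_sum, Finset.mul_sum]
    congr 1 <;> refine Finset.sum_congr rfl fun j _ => ?_ <;> ring
  · by_cases hl : l.Nodup
    · have hE : (N : ℝ) * S.wickForm Z = ∑ i : Fin N, ∑ q ∈ support N l,
          S.gram (.inl i) q * S.cofactor Z (.inl i) q := by
        rw [Finset.sum_congr rfl fun i _ =>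
          (S.wickForm_eq_sum_cofactor hs (ι_vecE_mul i l)).symm]
        simp
      have hF : (l.length : ℝ) * S.wickForm Z = ∑ i : Fin N, ∑ x ∈ l.toFinset,
          S.phi i x * S.cofactor Z (.inl i) (.inr (.inl x)) := by
        have hx : ∀ x ∈ l.toFinset, ∑ i : Fin N, S.phi i x * S.cofactor Z (.inl i) (.inr (.inl x)) =
            S.wickForm Z := fun x hx => by
          rw [S.wickForm_eq_sum_cofactor hs (p := .inr (.inl x))
            (ι_vecF_mul (List.mem_toFinset.1 hx) _)]
          simp only [support, Finset.sum_disjSum, gram, zero_mul, Finset.sum_const_zero, add_zero]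
          refine Finset.sum_congr rfl fun i _ => ?_
          rw [S.cofactor_swap, neg_mul, mul_neg]
        rw [Finset.sum_comm, Finset.sum_congr rfl hx, Finset.sum_const,
          List.toFinset_card_of_nodup hl, nsmul_eq_mul]
      rw [bordered, ← hZ, sub_mul, hE, hF, ← Finset.sum_sub_distrib]
      refine Finset.sum_congr rfl fun i _ => ?_
      simp only [support, Finset.sum_disjSum, gram]
      ring
    · have hZ0 : Z = 0 := pairProd_mul_of_not_nodup hl _
      simp [bordered, ← hZ, hZ0, cofactor, coordContract]

/-! ### The moment matrix and the kernel -/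

/-- A vector in the kernel of the moment matrix would give a combination of the `e_i` in the radical
of the form on their span, and make the Pfaffian of the moments vanish. -/
theorem isUnit_moment (h : S.bordered [] ≠ 0) : IsUnit S.moment := by
  rw [Matrix.isUnit_iff_isUnit_det, isUnit_iff_ne_zero]
  intro hdet
  obtain ⟨v, hv, hMv⟩ := Matrix.exists_mulVec_eq_zero_iff.2 hdet
  obtain ⟨k, hk⟩ := Function.ne_iff.1 hv
  -- the vector of the radical of the form on the span of the `e_i`
  set w : Fin N ⊕ Y ⊕ Y →₀ ℝ := ∑ i, v i • vecE N Y i with hw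
  have hform : ∀ j, S.form w (vecE N Y j) = 0 := fun j => by
    have := congrFun hMv j
    simp only [Matrix.mulVec, dotProduct, Pi.zero_apply] at this
    simp only [hw, map_sum, map_smul, LinearMap.sum_apply, LinearMap.smul_apply, smul_eq_mul]
    rw [← this]
    refine Finset.sum_congr rfl fun i _ => ?_
    rw [vecE, vecE, form, gramForm_single, gram, S.moment_skew j i, mul_comm]
  have hwE : ι ℝ w * prodE N Y = 0 := by
    rw [hw, map_sum, Finset.sum_mul]
    exact Finset.sum_eq_zero fun i _ => by rw [map_smul, smul_mul_assoc, ι_vecE_mul_prodE, smul_zero]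
  have hcE : contractLeft (S.form w) (prodE N Y) = 0 := by
    rw [prodE_eq]
    refine contractLeft_list_prod fun u hu => ?_
    obtain ⟨i, rfl⟩ := (List.mem_ofFn' _ _).1 hu
    exact hform i
  have hwk : w (.inl k) = v k := by
    rw [hw, Finsupp.finsetSum_apply, Finset.sum_eq_single k]
    · simp [vecE]
    · intro i _ hi
      simp [vecE, Finsupp.single_eq_of_ne (fun h => hi (Sum.inl.inj h).symm :
        (Sum.inl k : Fin N ⊕ Y ⊕ Y) ≠ Sum.inl i)]
    · simp
  have h1 := contractLeft_ι_mul (Q := 0)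
    (Finsupp.lapply (.inl k) : (Fin N ⊕ Y ⊕ Y →₀ ℝ) →ₗ[ℝ] ℝ) w (prodE N Y)
  have h2 : v k * S.wickForm (prodE N Y) = 0 := by
    rw [hwE, map_zero, Finsupp.lapply_apply, hwk, eq_comm, sub_eq_zero] at h1
    have h3 := congrArg S.wickForm h1
    rw [map_smul, wickForm, wick_ι_mul, contractLeft_comm, hcE, map_zero, neg_zero, map_zero,
      smul_eq_mul] at h3
    exact h3
  have hk' : v k ≠ 0 := hk
  refine h ?_
  simpa [bordered, pairProd, hk'] using h2

theorem bordered_nil {m : ℕ} (S : PfaffianSystem (2 * m) Y) :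
    S.bordered [] = (-1) ^ m * pfaffian S.moment := by
  have h := wick_ιMulti_eq_pfaffian S.form_isAlt m (vecE (2 * m) Y)
  simp only [bordered, pairProd, List.map_nil, List.prod_nil, one_mul, prodE]
  rw [wickForm, h]
  simp only [pfaffian, vecE, form, gramForm_single, gram, Matrix.of_apply, Finset.prod_neg,
    Finset.card_univ, Fintype.card_fin, Finset.mul_sum]
  refine Finset.sum_congr rfl fun σ _ => ?_
  ring

/-- The `2 × 2` matrix kernel of the system. -/
noncomputable def kernel (x y : Y) : Matrix (Fin 2) (Fin 2) ℝ :=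
  !![∑ i, ∑ j, S.phi i x * (S.moment⁻¹).transpose i j * S.phi j y,
     ∑ i, ∑ j, S.phi i x * (S.moment⁻¹).transpose i j * S.psi j y;
     ∑ i, ∑ j, S.psi i x * (S.moment⁻¹).transpose i j * S.phi j y,
     -S.eps x y + ∑ i, ∑ j, S.psi i x * (S.moment⁻¹).transpose i j * S.psi j y]

/-- The vectors `f_y` and `g_y`, indexed by `Fin 2`. -/
noncomputable def vecPair (N : ℕ) (y : Y) (a : Fin 2) : Fin N ⊕ Y ⊕ Y →₀ ℝ :=
  ![vecF N y, vecG N y] a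

theorem pairProd_ofFn (l : ℕ) (x : Fin l → Y) :
    pairProd N (List.ofFn x) = ιMulti ℝ (2 * l) fun a : Fin (2 * l) =>
      vecPair N (x ⟨(a : ℕ) / 2, by omega⟩) ⟨(a : ℕ) % 2, by omega⟩ := by
  induction l with
  | zero => exact (ιMulti_zero_apply _).symm
  | succ l ih =>
    rw [List.ofFn_succ, pairProd_cons, ih, mul_assoc]
    symm
    refine (ιMulti_succ_apply (R := ℝ) (n := 2 * l + 1) _).trans
      (congrArg₂ _ (congrArg _ ?_) ((ιMulti_succ_apply (R := ℝ) (n := 2 * l) _).trans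
        (congrArg₂ _ (congrArg _ ?_) (congrArg _ ?_))))
    · simp [vecPair]
    · simp [Matrix.vecTail, vecPair, Nat.mod_eq_of_lt (show 1 < 2 * (l + 1) by omega)]
    funext a
    simp only [Matrix.vecTail, Function.comp_apply, Fin.val_succ]
    have h1 : ((a : ℕ) + 1 + 1) / 2 = (a : ℕ) / 2 + 1 := by omega
    have h2 : ((a : ℕ) + 1 + 1) % 2 = (a : ℕ) % 2 := by omega
    simp only [h1, h2]
    rfl

theorem moment_inv_skew (i j : Fin N) : S.moment⁻¹ j i = -S.moment⁻¹ i j := by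
  have h1 : S.moment.transpose = -S.moment := by
    ext i j
    exact S.moment_skew j i
  have h2 := Matrix.transpose_nonsing_inv S.moment
  rw [h1] at h2
  have h3 : (-S.moment)⁻¹ = -S.moment⁻¹ := by
    by_cases h : IsUnit S.moment.det
    · refine Matrix.inv_eq_left_inv ?_
      rw [neg_mul_neg, Matrix.nonsing_inv_mul _ h]
    · rw [Matrix.nonsing_inv_apply_not_isUnit _ h, Matrix.nonsing_inv_apply_not_isUnit, neg_zero]
      rw [Matrix.det_neg]
      intro h'
      exact h (isUnit_of_mul_isUnit_right h')
  rw [h3] at h2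
  exact congrFun (congrFun h2 i) j

theorem kernel_skew (x y : Y) : (S.kernel x y).transpose = -S.kernel y x := by
  have key : ∀ u v : Fin N → ℝ, ∑ i, ∑ j, u i * (S.moment⁻¹).transpose i j * v j =
      -∑ i, ∑ j, v i * (S.moment⁻¹).transpose i j * u j := fun u v => by
    rw [Finset.sum_comm, ← Finset.sum_neg_distrib]
    refine Finset.sum_congr rfl fun i _ => ?_
    rw [← Finset.sum_neg_distrib]
    refine Finset.sum_congr rfl fun j _ => ?_
    rw [Matrix.transpose_apply, Matrix.transpose_apply, S.moment_inv_skew i j]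
    ring
  ext a b
  fin_cases a <;> fin_cases b
  · simpa [kernel] using key _ _
  · simpa [kernel] using key _ _
  · simpa [kernel] using key _ _
  · have := key (fun i => S.psi i x) (fun i => S.psi i y)
    simp only [kernel, Matrix.transpose_apply, Matrix.neg_apply] at this ⊢
    simp only [Fin.mk_one, Matrix.of_apply, Matrix.cons_val_one, Matrix.cons_val_fin_one]
    rw [this, S.eps_skew x y]
    ring

/-- The bordered Pfaffian by Schur complement with respect to the moment matrix. -/
theorem bordered_ofFn_eq_pfaffian_kernel (hM : IsUnit S.moment) (hN : Even N) (l : ℕ)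
    (x : Fin l → Y) :
    S.bordered (List.ofFn x) = S.bordered [] * pfaffian (kernelMatrix S.kernel x) := by
  have hdet := (Matrix.isUnit_iff_isUnit_det _).1 hM
  have hEE : ∀ i j, S.form (vecE N Y i) (vecE N Y j) = -S.moment i j := fun i j =>
    gramForm_single _ _ _
  -- the component of `w` orthogonal to all `e_i`
  set c : Fin N → (Fin N ⊕ Y ⊕ Y →₀ ℝ) →ₗ[ℝ] ℝ := fun i =>
    -∑ j, S.moment⁻¹ i j • S.form (vecE N Y j) with hc
  set h : (Fin N ⊕ Y ⊕ Y →₀ ℝ) →ₗ[ℝ] (Fin N ⊕ Y ⊕ Y →₀ ℝ) :=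
    LinearMap.id - ∑ i, (c i).smulRight (vecE N Y i) with hh
  have happ : ∀ w, h w = w - ∑ i, c i w • vecE N Y i := fun w => by
    simp [hh, LinearMap.sum_apply]
  have hcapp : ∀ i w, c i w = -∑ j, S.moment⁻¹ i j * S.form (vecE N Y j) w := fun i w => by
    simp [hc, LinearMap.sum_apply]
  have horth' : ∀ k w, S.form (vecE N Y k) (h w) = 0 := fun k w => by
    rw [happ, map_sub, map_sum]
    simp only [map_smul, smul_eq_mul, hEE, hcapp, neg_mul_neg, Finset.sum_mul]
    rw [Finset.sum_comm]
    have : ∀ j, ∑ i, S.moment⁻¹ i j * S.form (vecE N Y j) w * S.moment k i =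
        (1 : Matrix (Fin N) (Fin N) ℝ) k j * S.form (vecE N Y j) w := fun j => by
      rw [← Matrix.mul_nonsing_inv _ hdet, Matrix.mul_apply, Finset.sum_mul]
      refine Finset.sum_congr rfl fun i _ => ?_
      ring
    rw [Finset.sum_congr rfl fun j _ => this j]
    simp [Matrix.one_apply]
  have horth : ∀ k w, S.form (h w) (vecE N Y k) = 0 := fun k w => by
    rw [S.form_swap, horth', neg_zero]
  have hker : ∀ x y a b, (LinearMap.compl₁₂ S.form h h) (vecPair N x a) (vecPair N y b) =
      S.kernel x y a b := by
    intro x y a b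
    have h1 : ∀ u v, S.form (h u) (h v) = S.form u v +
        ∑ i, ∑ j, S.form (vecE N Y i) u * (S.moment⁻¹).transpose i j * S.form (vecE N Y j) v := by
      intro u v
      have : S.form (h u) (h v) = S.form u (h v) := by
        rw [happ u, map_sub, LinearMap.sub_apply, map_sum, LinearMap.sum_apply]
        simp [horth']
      rw [this, happ, map_sub, map_sum, sub_eq_add_neg, ← Finset.sum_neg_distrib]
      congr 1
      refine Finset.sum_congr rfl fun i _ => ?_
      rw [map_smul, smul_eq_mul, hcapp, S.form_swap u, neg_mul_neg, Finset.sum_mul,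
        ← Finset.sum_neg_distrib]
      refine Finset.sum_congr rfl fun j _ => ?_
      rw [Matrix.transpose_apply, S.moment_inv_skew i j]
      ring
    rw [LinearMap.compl₁₂_apply, h1]
    fin_cases a <;> fin_cases b <;>
      simp [vecPair, kernel, form, vecE, vecF, vecG, gramForm_single, gram]
  have hw := wick_list_prod_mul S.form_isAlt (l := List.ofFn (vecE N Y)) (by simpa using hN) h
    (by
      intro v hv w
      obtain ⟨i, rfl⟩ := (List.mem_ofFn' _ _).1 hv
      exact horth i w)
    (by
      intro w
      rw [happ, sub_sub_cancel]
      exact Submodule.sum_mem _ fun i _ => Submodule.smul_mem _ _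
        (Submodule.subset_span ((List.mem_ofFn' _ _).2 ⟨i, rfl⟩)))
    (S.form_isAlt.compl₁₂ h) (pairProd N (List.ofFn x))
  have hcomm := (commute_pairProd_prod (N := N) (List.ofFn x) (List.ofFn (vecE N Y))).eq
  rw [← prodE_eq] at hw hcomm
  rw [bordered, hcomm, wickForm, hw, pairProd_ofFn, wick_ιMulti_eq_pfaffian]
  simp only [hker]
  simp only [bordered, pairProd, List.map_nil, List.prod_nil, one_mul]
  rfl

end PfaffianSystem

/-! ### The Bures system and its density -/

theorem buresEps_swap (a b : ℝ) : buresEps a b = -buresEps b a := by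
  rw [buresEps, buresEps, ← neg_div, neg_sub, add_comm]

theorem abs_buresEps_le_one {a b : ℝ} (ha : 0 < a) (hb : 0 < b) : |buresEps a b| ≤ 1 := by
  rw [buresEps, abs_div, abs_of_pos (add_pos ha hb), div_le_one (add_pos ha hb), abs_le]
  constructor <;> linarith

/-- The addition formula of the hyperbolic tangent, in terms of the logarithms of the points. -/
theorem buresEps_mul_one_sub {a b y : ℝ} (ha : 0 < a) (hb : 0 < b) (hy : 0 < y) :
    buresEps a b * (1 - buresEps a y * buresEps b y) = buresEps a y - buresEps b y := by
  unfold buresEps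
  field_simp
  ring

/-- Two different points control all others: `ε(a, y)` and `ε(b, y)` are not both small. -/
theorem abs_buresEps_le {a b y : ℝ} (ha : 0 < a) (hb : 0 < b) (hy : 0 < y) :
    |buresEps a b| ≤ 2 * (|buresEps a y| + |buresEps b y|) := by
  have h1 := abs_buresEps_le_one ha hy
  have h2 := abs_buresEps_le_one hb hy
  have h3 := abs_buresEps_le_one ha hb
  have h := buresEps_mul_one_sub ha hb hy
  have h4 : buresEps a b = buresEps a y - buresEps b y +
      buresEps a b * (buresEps a y * buresEps b y) := by linarith
  have h5 : |buresEps a b * (buresEps a y * buresEps b y)| ≤ |buresEps a y| := by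
    rw [abs_mul, abs_mul]
    calc _ ≤ 1 * (|buresEps a y| * 1) := by gcongr
      _ = _ := by ring
  have h6 := abs_add_le (buresEps a y - buresEps b y)
    (buresEps a b * (buresEps a y * buresEps b y))
  have h7 := abs_sub (buresEps a y) (buresEps b y)
  rw [← h4] at h6
  have := abs_nonneg (buresEps b y)
  linarith

section

variable {X : Set ℝ}

/-- The Pfaffian system of the Bures ensemble: monomials, the function `ε` and the moments. -/
noncomputable def buresSystem (m : ℕ) (μ : Measure X) [SFinite μ] : PfaffianSystem (2 * m) X where
  moment := buresMoment m μ
  phi i x := (x : ℝ) ^ (i : ℕ)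
  psi i x := epsDot μ i x
  eps x y := buresEps x y
  moment_skew i j := by
    simp only [buresMoment, Matrix.of_apply]
    rw [← integral_prod_swap, ← integral_neg]
    refine integral_congr_ae (Filter.Eventually.of_forall fun p => ?_)
    simp only [Prod.fst_swap, Prod.snd_swap]
    rw [buresEps_swap]
    ring
  eps_skew x y := buresEps_swap x y

/-- The Bures density is a bordered Pfaffian: the product of a Vandermonde determinant and of
Schur's Pfaffian. -/
theorem bordered_ofFn_eq_buresDensity (hX : X ⊆ Set.Ioi 0) (m : ℕ) (μ : Measure X) [SFinite μ]
    {n : ℕ} (hn : n = 2 * m) (z : Fin n → X) :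
    (buresSystem m μ).bordered (List.ofFn z) = buresDensity fun i => (z i : ℝ) := by
  subst hn
  rw [PfaffianSystem.bordered_ofFn]
  have hdet := Matrix.det_vandermonde fun i => (z i : ℝ)
  have hpf := pfaffian_buresEps m (fun i => (z i : ℝ)) fun i => hX (z i).2
  have h1 : (Matrix.of fun i j => (buresSystem m μ).phi j (z i)).det =
      ∏ i, ∏ j ∈ Finset.Ioi i, ((z j : ℝ) - z i) := hdet
  have h2 : pfaffian (Matrix.of fun i j => (buresSystem m μ).eps (z j) (z i)) =
      ∏ i, ∏ j ∈ Finset.Ioi i, buresEps (z j) (z i) := hpf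
  rw [h1, h2, ← Finset.prod_mul_distrib]
  refine Finset.prod_congr rfl fun i _ => ?_
  rw [← Finset.prod_mul_distrib]
  refine Finset.prod_congr rfl fun j _ => ?_
  rw [buresEps, add_comm (z j : ℝ)]
  ring

theorem buresDensity_nonneg {n : ℕ} {z : Fin n → ℝ} (hz : ∀ i, 0 < z i) : 0 ≤ buresDensity z :=
  Finset.prod_nonneg fun i _ => Finset.prod_nonneg fun j _ =>
    div_nonneg (sq_nonneg _) (add_pos (hz i) (hz j)).le

theorem buresDensity_pos {n : ℕ} {z : Fin n → ℝ} (hz : ∀ i, 0 < z i)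
    (hinj : Function.Injective z) : 0 < buresDensity z :=
  Finset.prod_pos fun i _ => Finset.prod_pos fun j hj =>
    div_pos (sq_pos_iff.2 (sub_ne_zero.2 fun h =>
      (Finset.mem_Ioi.1 hj).ne (hinj h))) (add_pos (hz i) (hz j))

theorem buresDensity_eq_zero {n : ℕ} {z : Fin n → ℝ} (hinj : ¬ Function.Injective z) :
    buresDensity z = 0 := by
  simp only [Function.Injective, not_forall] at hinj
  obtain ⟨i, j, h, hij⟩ := hinj
  wlog hlt : i < j generalizing i j
  · exact this j i h.symm (Ne.symm hij) (lt_of_le_of_ne (not_lt.1 hlt) (Ne.symm hij))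
  exact Finset.prod_eq_zero (Finset.mem_univ i)
    (Finset.prod_eq_zero (Finset.mem_Ioi.2 hlt) (by simp [h]))

theorem measurable_buresDensity (n : ℕ) : Measurable (buresDensity (n := n)) := by
  unfold buresDensity
  fun_prop

theorem measurable_fin_append {Y : Type*} [MeasurableSpace Y] {l k : ℕ} :
    Measurable fun p : (Fin l → Y) × (Fin k → Y) => Fin.append p.1 p.2 := by
  refine measurable_pi_iff.2 fun i => ?_
  induction i using Fin.addCases with
  | left i =>
    simp only [Fin.append_left]
    exact (measurable_pi_apply i).comp measurable_fst
  | right i =>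
    simp only [Fin.append_right]
    exact (measurable_pi_apply i).comp measurable_snd

theorem measurable_coe_pi {n : ℕ} : Measurable fun (z : Fin n → X) i => (z i : ℝ) :=
  measurable_pi_iff.2 fun i => measurable_subtype_coe.comp (measurable_pi_apply i)

/-- The bordered Pfaffian of `l` fixed points and `2m - l` further ones, as a density. -/
theorem bordered_append_ofFn (hX : X ⊆ Set.Ioi 0) (m : ℕ) (μ : Measure X) [SFinite μ]
    {l k : ℕ} (h : l + k = 2 * m) (x : Fin l → X) (y : Fin k → X) :
    (buresSystem m μ).bordered (List.ofFn x ++ List.ofFn y) = buresSection x k y := by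
  rw [← List.ofFn_fin_append, bordered_ofFn_eq_buresDensity hX m μ h]
  rfl

theorem measurable_buresSection {l : ℕ} (x : Fin l → X) (k : ℕ) :
    Measurable (buresSection x k) := by
  have h : Measurable fun y : Fin k → X => Fin.append x y :=
    measurable_fin_append.comp measurable_prodMk_left
  exact (measurable_buresDensity (l + k)).comp (measurable_coe_pi.comp h)

/-! ### Integrability -/

/-- The hypotheses on the measure: its points are positive, the moments exist, and it is not
concentrated on fewer than `2m` points. -/
structure BuresAdmissible (m : ℕ) (μ : Measure X) : Prop where
  pos : X ⊆ Set.Ioi 0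
  moment : ∀ i j : Fin (2 * m), Integrable
    (fun p : X × X => (p.1 : ℝ) ^ (i : ℕ) * (p.2 : ℝ) ^ (j : ℕ) * buresEps p.1 p.2) (μ.prod μ)
  not_concentrated : ∀ F : Finset X, F.card < 2 * m → μ ((F : Set X)ᶜ) ≠ 0

/-- The monomials are integrable: the sections of the moment integrands at two different points
dominate them. -/
theorem BuresAdmissible.integrable_pow {m : ℕ} {μ : Measure X} [SFinite μ]
    (h : BuresAdmissible m μ) (j : Fin (2 * m)) :
    Integrable (fun y : X => (y : ℝ) ^ (j : ℕ)) μ := by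
  have hX := h.pos
  have hae := (h.moment j j).prod_right_ae
  have hm : 1 < 2 * m := by have := j.2; omega
  have hex : ∀ F : Finset X, F.card < 2 * m → ∃ x ∉ F, Integrable
      (fun y : X => (x : ℝ) ^ (j : ℕ) * (y : ℝ) ^ (j : ℕ) * buresEps x y) μ := by
    intro F hF
    by_contra! hcon
    refine h.not_concentrated F hF (measure_mono_null (fun x hx => ?_) hae)
    exact hcon x (by simpa using hx)
  obtain ⟨a, -, ha⟩ := hex ∅ (by simpa using hm.trans' zero_lt_one)
  obtain ⟨b, hb', hb⟩ := hex {a} (by simpa using hm)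
  have hab : (a : ℝ) ≠ b := fun h => hb' (by simp [Subtype.ext h])
  have ha0 : (0 : ℝ) < a := hX a.2
  have hb0 : (0 : ℝ) < b := hX b.2
  set c := |buresEps a b| with hc
  have hc0 : 0 < c := abs_pos.2 (div_ne_zero (sub_ne_zero.2 hab) (add_pos ha0 hb0).ne')
  have hsec : ∀ x : X, Integrable
      (fun y : X => (x : ℝ) ^ (j : ℕ) * (y : ℝ) ^ (j : ℕ) * buresEps x y) μ →
      Integrable (fun y : X => |(y : ℝ) ^ (j : ℕ) * buresEps x y|) μ := by
    intro x hx
    have hx0 : (0 : ℝ) < x := hX x.2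
    have := (hx.const_mul ((x : ℝ) ^ (j : ℕ))⁻¹).abs
    refine this.congr (Filter.Eventually.of_forall fun y => ?_)
    have : (x : ℝ) ^ (j : ℕ) ≠ 0 := by positivity
    simp only
    rw [mul_assoc, inv_mul_cancel_left₀ this]
  refine (((hsec a ha).add (hsec b hb)).const_mul (2 / c)).mono'
    (measurable_subtype_coe.pow_const _).aestronglyMeasurable
    (Filter.Eventually.of_forall fun y => ?_)
  have hy0 : (0 : ℝ) < y := hX y.2
  have hyj : (0 : ℝ) < (y : ℝ) ^ (j : ℕ) := by positivity
  have h1 := abs_buresEps_le ha0 hb0 hy0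
  rw [Real.norm_eq_abs, abs_of_pos hyj]
  simp only [Pi.add_apply, abs_mul, abs_of_pos hyj]
  rw [div_mul_eq_mul_div, le_div_iff₀ hc0]
  calc (y : ℝ) ^ (j : ℕ) * c ≤ (y : ℝ) ^ (j : ℕ) * (2 * (|buresEps a y| + |buresEps b y|)) := by
        gcongr
    _ = _ := by ring

theorem integrable_buresEps_mul_pow (hX : X ⊆ Set.Ioi 0) {μ : Measure X} {j : ℕ}
    (hint : Integrable (fun y : X => (y : ℝ) ^ j) μ) (x : X) :
    Integrable (fun y : X => buresEps x y * (y : ℝ) ^ j) μ := by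
  refine hint.mono' ?_ (Filter.Eventually.of_forall fun y => ?_)
  · have h : Measurable fun y : X => (y : ℝ) := measurable_subtype_coe
    unfold buresEps
    exact Measurable.aestronglyMeasurable (by fun_prop)
  · have hyj : (0 : ℝ) < (y : ℝ) ^ j := pow_pos (hX y.2) _
    rw [Real.norm_eq_abs, abs_mul, abs_of_pos hyj]
    exact mul_le_of_le_one_left hyj.le (abs_buresEps_le_one (hX x.2) (hX y.2))

/-- Integrating out one point. -/
theorem BuresAdmissible.integral_bordered_cons {m : ℕ} {μ : Measure X} [SFinite μ]
    (h : BuresAdmissible m μ) (l : List X) :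
    Integrable (fun y => (buresSystem m μ).bordered (y :: l)) μ ∧
      ∫ y, (buresSystem m μ).bordered (y :: l) ∂μ =
        (((2 * m : ℕ) : ℝ) - l.length) * (buresSystem m μ).bordered l := by
  classical
  have hX := h.pos
  have hmoment := h.moment
  have hint := h.integrable_pow
  obtain ⟨c, d, h1, h2⟩ := (buresSystem m μ).exists_bordered_cons_eq l
  have hpsi : ∀ i j : Fin (2 * m), (fun y : X => (y : ℝ) ^ (i : ℕ) * epsDot μ j y) =
      fun y : X => ∫ w : X, (y : ℝ) ^ (i : ℕ) * (w : ℝ) ^ (j : ℕ) * buresEps y w ∂μ := by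
    intro i j
    funext y
    rw [epsDot, ← integral_const_mul]
    refine integral_congr_ae (Filter.Eventually.of_forall fun w => ?_)
    simp only
    ring
  have hi1 : ∀ i j : Fin (2 * m), Integrable (fun y : X => (y : ℝ) ^ (i : ℕ) * epsDot μ j y) μ := by
    intro i j
    rw [hpsi]
    exact (hmoment i j).integral_prod_left
  have he1 : ∀ i j : Fin (2 * m), ∫ y : X, (y : ℝ) ^ (i : ℕ) * epsDot μ j y ∂μ =
      buresMoment m μ i j := by
    intro i j
    rw [hpsi]
    exact (integral_prod _ (hmoment i j)).symm
  have hfun : ∀ (i : Fin (2 * m)) (x : X), (fun y : X => (y : ℝ) ^ (i : ℕ) * buresEps y x) =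
      fun y : X => -(buresEps x y * (y : ℝ) ^ (i : ℕ)) := by
    intro i x
    funext y
    rw [buresEps_swap]
    ring
  have hi2 : ∀ (i : Fin (2 * m)) (x : X),
      Integrable (fun y : X => (y : ℝ) ^ (i : ℕ) * buresEps y x) μ := by
    intro i x
    rw [hfun]
    exact (integrable_buresEps_mul_pow hX (hint i) x).neg
  have he2 : ∀ (i : Fin (2 * m)) (x : X), ∫ y : X, (y : ℝ) ^ (i : ℕ) * buresEps y x ∂μ =
      -epsDot μ i x := by
    intro i x
    rw [hfun, integral_neg]
    rfl
  have hI1 : ∀ i j : Fin (2 * m), Integrable (fun y : X =>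
      -((buresSystem m μ).phi i y * (buresSystem m μ).psi j y) * c i j) μ := fun i j =>
    (hi1 i j).neg.mul_const _
  have hI2 : ∀ (i : Fin (2 * m)) (x : X), Integrable (fun y : X =>
      -((buresSystem m μ).phi i y * (buresSystem m μ).eps y x) * d i x) μ := fun i x =>
    (hi2 i x).neg.mul_const _
  have hS1 : ∀ i : Fin (2 * m), Integrable (fun y : X => ∑ j,
      -((buresSystem m μ).phi i y * (buresSystem m μ).psi j y) * c i j) μ := fun i =>
    integrable_finsetSum _ fun j _ => hI1 i j
  have hS2 : ∀ i : Fin (2 * m), Integrable (fun y : X => ∑ x ∈ l.toFinset,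
      -((buresSystem m μ).phi i y * (buresSystem m μ).eps y x) * d i x) μ := fun i =>
    integrable_finsetSum _ fun x _ => hI2 i x
  have hS : ∀ i : Fin (2 * m), Integrable (fun y : X => ∑ j,
      -((buresSystem m μ).phi i y * (buresSystem m μ).psi j y) * c i j +
      ∑ x ∈ l.toFinset, -((buresSystem m μ).phi i y * (buresSystem m μ).eps y x) * d i x) μ :=
    fun i => (hS1 i).add (hS2 i)
  simp only [h1]
  refine ⟨integrable_finsetSum _ fun i _ => hS i, ?_⟩
  rw [h2, integral_finsetSum _ fun i _ => hS i]
  refine Finset.sum_congr rfl fun i _ => ?_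
  rw [integral_add (hS1 i) (hS2 i), integral_finsetSum _ fun j _ => hI1 i j,
    integral_finsetSum _ fun x _ => hI2 i x]
  congr 1
  · refine Finset.sum_congr rfl fun j _ => ?_
    rw [integral_mul_const, integral_neg]
    congr 2
    exact he1 i j
  · refine Finset.sum_congr rfl fun x _ => ?_
    rw [integral_mul_const, integral_neg]
    congr 1
    exact neg_eq_iff_eq_neg.2 (he2 i x)

/-- Positivity of the bordered Pfaffians, from the density downwards. -/
theorem BuresAdmissible.bordered_nonneg_and_pos {m : ℕ} {μ : Measure X} [SFinite μ]
    (h : BuresAdmissible m μ) (k : ℕ) (l : List X)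
    (hl : l.length + k = 2 * m) :
    0 ≤ (buresSystem m μ).bordered l ∧ (l.Nodup → 0 < (buresSystem m μ).bordered l) := by
  classical
  have hX := h.pos
  induction k generalizing l with
  | zero =>
    have hd := bordered_ofFn_eq_buresDensity hX m μ hl l.get
    rw [List.ofFn_get] at hd
    rw [hd]
    refine ⟨buresDensity_nonneg fun i => hX (l.get i).2, fun hnd => ?_⟩
    exact buresDensity_pos (fun i => hX (l.get i).2)
      (Subtype.val_injective.comp (List.nodup_iff_injective_get.1 hnd))
  | succ k ih =>
    obtain ⟨h1, h2⟩ := h.integral_bordered_cons l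
    have hc : (0 : ℝ) < ((2 * m : ℕ) : ℝ) - l.length := by
      rw [← hl]; push_cast; linarith [(Nat.cast_nonneg k : (0 : ℝ) ≤ k)]
    have hnn : ∀ y, 0 ≤ (buresSystem m μ).bordered (y :: l) := fun y =>
      (ih (y :: l) (by rw [List.length_cons]; omega)).1
    constructor
    · exact nonneg_of_mul_nonneg_right (h2 ▸ integral_nonneg hnn) hc
    · intro hnd
      refine pos_of_mul_pos_right (h2 ▸ ?_) hc.le
      rw [integral_pos_iff_support_of_nonneg hnn h1, pos_iff_ne_zero]
      have hF : l.toFinset.card < 2 * m := (List.toFinset_card_le l).trans_lt (by omega)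
      refine fun h0 => h.not_concentrated l.toFinset hF (measure_mono_null (fun y hy => ?_) h0)
      have hy' : y ∉ l := by simpa using hy
      exact ((ih (y :: l) (by rw [List.length_cons]; omega)).2 (List.nodup_cons.2 ⟨hy', hnd⟩)).ne'

end

/-! ### Integrating out several points -/

section

variable {X : Set ℝ}

theorem BuresAdmissible.isFiniteMeasure {m : ℕ} {μ : Measure X} [SFinite μ]
    (h : BuresAdmissible m μ) (hm : 0 < m) : IsFiniteMeasure μ := by
  have : Integrable (fun _ : X => (1 : ℝ)) μ := by
    simpa using h.integrable_pow ⟨0, by omega⟩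
  exact (integrable_const_iff_isFiniteMeasure one_ne_zero).1 this

theorem lintegral_pi_fin_succ {Y : Type*} [MeasurableSpace Y] (μ : Measure Y) [SigmaFinite μ]
    {k : ℕ} (F : (Fin (k + 1) → Y) → ℝ≥0∞) (hF : Measurable F) :
    ∫⁻ z, F z ∂(Measure.pi fun _ => μ) =
      ∫⁻ a, ∫⁻ b : Fin k → Y, F (Fin.cons a b) ∂(Measure.pi fun _ => μ) ∂μ := by
  have mp := (measurePreserving_piFinSuccAbove (fun _ : Fin (k + 1) => μ) 0).symm
  rw [← mp.lintegral_comp hF]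
  refine (lintegral_prod _ (hF.comp mp.measurable).aemeasurable).trans ?_
  refine lintegral_congr fun a => lintegral_congr fun b => congrArg F ?_
  simp [MeasurableEquiv.piFinSuccAbove_symm_apply, Fin.insertNthEquiv]

/-- The iterated integral over the last `k` points, by induction on `k`. Working with `∫⁻` gives
convergence and value at once. -/
theorem BuresAdmissible.lintegral_bordered {m : ℕ} {μ : Measure X} [SFinite μ]
    (h : BuresAdmissible m μ) (k : ℕ) (l : List X) (hl : l.length + k = 2 * m) :
    ∫⁻ y : Fin k → X, ENNReal.ofReal ((buresSystem m μ).bordered (l ++ List.ofFn y))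
        ∂(Measure.pi fun _ : Fin k => μ) =
      ENNReal.ofReal ((k ! : ℝ) * (buresSystem m μ).bordered l) := by
  induction k generalizing l with
  | zero =>
    rw [Measure.pi_of_empty, lintegral_dirac]
    simp
  | succ k ih =>
    have := h.isFiniteMeasure (by omega)
    have hmeas : Measurable fun y : Fin (k + 1) → X =>
        ENNReal.ofReal ((buresSystem m μ).bordered (l ++ List.ofFn y)) := by
      have h1 : (fun y : Fin (k + 1) → X => (buresSystem m μ).bordered (l ++ List.ofFn y)) =
          fun y => buresSection l.get (k + 1) y := by
        funext y
        rw [← bordered_append_ofFn h.pos m μ hl, List.ofFn_get]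
      refine Measurable.ennreal_ofReal ?_
      rw [h1]
      exact measurable_buresSection l.get (k + 1)
    rw [lintegral_pi_fin_succ μ _ hmeas]
    have hin : ∀ a : X, ∫⁻ b : Fin k → X, ENNReal.ofReal ((buresSystem m μ).bordered
        (l ++ List.ofFn (Fin.cons a b : Fin (k + 1) → X))) ∂(Measure.pi fun _ : Fin k => μ) =
        ENNReal.ofReal ((k ! : ℝ) * (buresSystem m μ).bordered (a :: l)) := by
      intro a
      have hcons : ∀ b : Fin k → X,
          l ++ List.ofFn (Fin.cons a b : Fin (k + 1) → X) = (l ++ [a]) ++ List.ofFn b := by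
        intro b
        simp [List.ofFn_succ]
      simp only [hcons]
      rw [ih (l ++ [a]) (by simp; omega),
        (buresSystem m μ).bordered_perm (List.perm_append_singleton a l)]
    refine (lintegral_congr hin).trans ?_
    obtain ⟨h1, h2⟩ := h.integral_bordered_cons l
    have hN : ((2 * m : ℕ) : ℝ) - l.length = k + 1 := by
      rw [← hl]
      push_cast
      ring
    rw [← ofReal_integral_eq_lintegral_ofReal (h1.const_mul _) (Filter.Eventually.of_forall
      fun y => mul_nonneg (Nat.cast_nonneg _)
        (h.bordered_nonneg_and_pos k (y :: l) (by rw [List.length_cons]; omega)).1),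
      integral_const_mul, h2, hN, Nat.factorial_succ]
    congr 1
    push_cast
    ring

theorem BuresAdmissible.bordered_nil_pos {m : ℕ} {μ : Measure X} [SFinite μ]
    (h : BuresAdmissible m μ) : 0 < (buresSystem m μ).bordered [] :=
  (h.bordered_nonneg_and_pos (2 * m) [] (by simp)).2 List.nodup_nil

theorem BuresAdmissible.bordered_ofFn {m : ℕ} {μ : Measure X} [SFinite μ]
    (h : BuresAdmissible m μ) {l : ℕ} (x : Fin l → X) :
    (buresSystem m μ).bordered (List.ofFn x) =
      (buresSystem m μ).bordered [] * pfaffian (kernelMatrix (buresKernel m μ) x) :=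
  (buresSystem m μ).bordered_ofFn_eq_pfaffian_kernel
    ((buresSystem m μ).isUnit_moment h.bordered_nil_pos.ne') (even_two_mul m) l x

theorem BuresAdmissible.buresSection_nonneg {m : ℕ} {μ : Measure X}
    (h : BuresAdmissible m μ) {l : ℕ} (x : Fin l → X) (k : ℕ) (y : Fin k → X) :
    0 ≤ buresSection x k y :=
  buresDensity_nonneg fun i => h.pos (Fin.append x y i).2

theorem BuresAdmissible.lintegral_buresSection {m : ℕ} {μ : Measure X} [SFinite μ]
    (h : BuresAdmissible m μ) {l k : ℕ} (hl : l + k = 2 * m) (x : Fin l → X) :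
    ∫⁻ y : Fin k → X, ENNReal.ofReal (buresSection x k y) ∂(Measure.pi fun _ : Fin k => μ) =
      ENNReal.ofReal ((k ! : ℝ) * (buresSystem m μ).bordered (List.ofFn x)) := by
  rw [← h.lintegral_bordered k (List.ofFn x) (by simpa using hl)]
  simp only [bordered_append_ofFn h.pos m μ hl]

theorem BuresAdmissible.integrable_buresSection {m : ℕ} {μ : Measure X} [SFinite μ]
    (h : BuresAdmissible m μ) {l k : ℕ} (hl : l + k = 2 * m) (x : Fin l → X) :
    Integrable (buresSection x k) (Measure.pi fun _ : Fin k => μ) := by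
  refine ⟨(measurable_buresSection x k).aestronglyMeasurable, ?_⟩
  rw [hasFiniteIntegral_iff_ofReal (Filter.Eventually.of_forall (h.buresSection_nonneg x k)),
    h.lintegral_buresSection hl]
  exact ENNReal.ofReal_lt_top

theorem BuresAdmissible.integral_buresSection {m : ℕ} {μ : Measure X} [SFinite μ]
    (h : BuresAdmissible m μ) {l k : ℕ} (hl : l + k = 2 * m) (x : Fin l → X) :
    ∫ y, buresSection x k y ∂(Measure.pi fun _ : Fin k => μ) =
      (k ! : ℝ) * (buresSystem m μ).bordered (List.ofFn x) := by
  rw [integral_eq_lintegral_of_nonneg_ae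
    (Filter.Eventually.of_forall (h.buresSection_nonneg x k))
    (h.integrable_buresSection hl x).aestronglyMeasurable, h.lintegral_buresSection hl,
    ENNReal.toReal_ofReal]
  exact mul_nonneg (Nat.cast_nonneg _)
    (h.bordered_nonneg_and_pos k _ (by simpa using hl)).1

theorem buresSection_elim0 {k : ℕ} (y : Fin k → X) :
    buresSection (Fin.elim0 : Fin 0 → X) k y = buresDensity fun i => (y i : ℝ) := by
  have key : ∀ (n : ℕ) (hn : n = k) (z : Fin n → X), (∀ i, z i = y (Fin.cast hn i)) →
      buresDensity (fun i => (z i : ℝ)) = buresDensity fun i => (y i : ℝ) := by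
    intro n hn z hz
    subst hn
    congr 1
    funext i
    rw [hz i]
    rfl
  refine key (0 + k) (zero_add k) _ fun i => ?_
  rw [Fin.elim0_append]
  rfl

theorem BuresAdmissible.integrable_buresDensity {m : ℕ} {μ : Measure X} [SFinite μ]
    (h : BuresAdmissible m μ) :
    Integrable (fun z : Fin (2 * m) → X => buresDensity (fun i => (z i : ℝ)))
      (Measure.pi fun _ => μ) :=
  (h.integrable_buresSection (l := 0) (k := 2 * m) (by simp) Fin.elim0).congr
    (Filter.Eventually.of_forall buresSection_elim0)

theorem BuresAdmissible.buresTau_eq {m : ℕ} {μ : Measure X} [SFinite μ]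
    (h : BuresAdmissible m μ) : buresTau (2 * m) μ = (buresSystem m μ).bordered [] := by
  have := h.integral_buresSection (l := 0) (k := 2 * m) (by simp) Fin.elim0
  simp only [buresSection_elim0, List.ofFn_zero] at this
  rw [buresTau, this]
  field_simp

theorem BuresAdmissible.buresCorrelation_eq {m : ℕ} {μ : Measure X} [SFinite μ]
    (h : BuresAdmissible m μ) {l : ℕ} (hl : l ≤ 2 * m) (x : Fin l → X) :
    buresCorrelation m μ x = pfaffian (kernelMatrix (buresKernel m μ) x) := by
  have h0 := h.bordered_nil_pos
  have h1 : (buresSystem m μ).bordered [] = (-1) ^ m * pfaffian (buresMoment m μ) :=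
    (buresSystem m μ).bordered_nil
  rw [buresCorrelation, h.integral_buresSection (Nat.add_sub_cancel' hl), h.bordered_ofFn, ← h1]
  field_simp

/-! ### The point process -/

theorem BuresAdmissible.pfaffian_nonneg {m : ℕ} {μ : Measure X} [SFinite μ]
    (h : BuresAdmissible m μ) {l : ℕ} (x : Fin l → X) :
    0 ≤ pfaffian (kernelMatrix (buresKernel m μ) x) := by
  refine nonneg_of_mul_nonneg_right (h.bordered_ofFn x ▸ ?_) h.bordered_nil_pos
  rcases le_or_gt l (2 * m) with hl | hl
  · exact (h.bordered_nonneg_and_pos (2 * m - l) _ (by simp; omega)).1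
  · rw [PfaffianSystem.bordered_of_lt _ (by simpa using hl)]

theorem BuresAdmissible.pfaffian_eq_zero {m : ℕ} {μ : Measure X} [SFinite μ]
    (h : BuresAdmissible m μ) {l : ℕ} (hl : 2 * m < l) (x : Fin l → X) :
    pfaffian (kernelMatrix (buresKernel m μ) x) = 0 := by
  have h1 := h.bordered_ofFn x
  rw [PfaffianSystem.bordered_of_lt _ (by simpa using hl), eq_comm, mul_eq_zero] at h1
  exact h1.resolve_left h.bordered_nil_pos.ne'

theorem BuresAdmissible.buresDensity_perm {m : ℕ} {μ : Measure X} [SFinite μ]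
    (h : BuresAdmissible m μ) (σ : Equiv.Perm (Fin (2 * m))) (z : Fin (2 * m) → X) :
    buresDensity (fun i => (z (σ i) : ℝ)) = buresDensity fun i => (z i : ℝ) := by
  rw [← bordered_ofFn_eq_buresDensity h.pos m μ rfl z,
    ← bordered_ofFn_eq_buresDensity h.pos m μ rfl fun i => z (σ i)]
  exact (buresSystem m μ).bordered_perm (Equiv.Perm.ofFn_comp_perm σ z)

theorem measurePreserving_pi_comp_perm {Y : Type*} [MeasurableSpace Y] (μ : Measure Y)
    [SigmaFinite μ] {n : ℕ} (σ : Equiv.Perm (Fin n)) :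
    MeasurePreserving (fun z : Fin n → Y => z ∘ σ) (Measure.pi fun _ => μ)
      (Measure.pi fun _ => μ) :=
  (measurePreserving_piCongrLeft (fun _ : Fin n => μ) σ).symm

theorem lintegral_pi_fin_append {Y : Type*} [MeasurableSpace Y] (μ : Measure Y)
    [SigmaFinite μ] {n l k : ℕ} (hn : n = l + k) (F : (Fin n → Y) → ℝ≥0∞) (hF : Measurable F) :
    ∫⁻ z, F z ∂(Measure.pi fun _ => μ) = ∫⁻ x : Fin l → Y, ∫⁻ y : Fin k → Y,
      F (fun i => Fin.append x y (Fin.cast hn i)) ∂(Measure.pi fun _ => μ)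
        ∂(Measure.pi fun _ => μ) := by
  subst hn
  have m1 := measurePreserving_piCongrLeft (fun _ : Fin (l + k) => μ) finSumFinEquiv
  have m2 := measurePreserving_sumPiEquivProdPi_symm (fun _ : Fin l ⊕ Fin k => μ)
  have m3 := m1.comp m2
  rw [← m3.lintegral_comp hF]
  refine (lintegral_prod _ (hF.comp m3.measurable).aemeasurable).trans ?_
  refine lintegral_congr fun x => lintegral_congr fun y => congrArg F (funext fun i => ?_)
  simp only [Function.comp_apply, Fin.cast_refl, id]
  induction i using Fin.addCases with
  | left i =>
    rw [Fin.append_left, ← finSumFinEquiv_apply_left]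
    exact Equiv.piCongrLeft_apply_apply (fun _ => Y) finSumFinEquiv _ (Sum.inl i)
  | right i =>
    rw [Fin.append_right, ← finSumFinEquiv_apply_right]
    exact Equiv.piCongrLeft_apply_apply (fun _ => Y) finSumFinEquiv _ (Sum.inr i)

theorem BuresAdmissible.const_pos {m : ℕ} {μ : Measure X} [SFinite μ]
    (h : BuresAdmissible m μ) : 0 < ((2 * m)! : ℝ) * buresTau (2 * m) μ := by
  rw [h.buresTau_eq]
  exact mul_pos (Nat.cast_pos.2 (Nat.factorial_pos _)) h.bordered_nil_pos

theorem measurable_law_density (m : ℕ) (μ : Measure X) :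
    Measurable fun z : Fin (2 * m) → X => ENNReal.ofReal
      (buresDensity (fun i => (z i : ℝ)) / (((2 * m)! : ℝ) * buresTau (2 * m) μ)) :=
  (((measurable_buresDensity _).comp measurable_coe_pi).div_const _).ennreal_ofReal

theorem BuresAdmissible.isProbabilityMeasure_law {m : ℕ} {μ : Measure X} [SFinite μ]
    (h : BuresAdmissible m μ) : IsProbabilityMeasure (buresLaw m μ) := by
  constructor
  have h1 := h.lintegral_buresSection (l := 0) (k := 2 * m) (by simp) Fin.elim0
  simp only [buresSection_elim0, List.ofFn_zero] at h1
  rw [buresLaw, withDensity_apply _ MeasurableSet.univ, Measure.restrict_univ]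
  simp only [ENNReal.ofReal_div_of_pos h.const_pos]
  simp only [div_eq_mul_inv]
  rw [lintegral_mul_const' _ _ (ENNReal.inv_ne_top.2 (ENNReal.ofReal_pos.2 h.const_pos).ne'), h1, ← h.buresTau_eq]
  exact ENNReal.mul_inv_cancel (ENNReal.ofReal_pos.2 h.const_pos).ne' ENNReal.ofReal_ne_top

/-- All ordered choices of `l` of the points contribute equally. -/
theorem BuresAdmissible.lintegral_embedding {m : ℕ} {μ : Measure X} [SFinite μ] [SigmaFinite μ]
    (h : BuresAdmissible m μ) {l k : ℕ} (hl : 2 * m = l + k) (f : (Fin l → X) → ℝ≥0∞)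
    (hf : Measurable f) (e : Fin l ↪ Fin (2 * m)) :
    ∫⁻ z, f (z ∘ e) ∂(buresLaw m μ) =
      ∫⁻ x, f x * (ENNReal.ofReal ((k ! : ℝ) * (buresSystem m μ).bordered (List.ofFn x)) *
        (ENNReal.ofReal (((2 * m)! : ℝ) * buresTau (2 * m) μ))⁻¹)
        ∂(Measure.pi fun _ : Fin l => μ) := by
  set e₀ : Fin l ↪ Fin (2 * m) := Fin.castLEEmb (by omega) with he₀
  set D : (Fin (2 * m) → X) → ℝ≥0∞ := fun z => ENNReal.ofReal
      (buresDensity (fun i => (z i : ℝ)) / (((2 * m)! : ℝ) * buresTau (2 * m) μ)) with hD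
  have hDm : Measurable D := measurable_law_density m μ
  have hcomp : ∀ e : Fin l ↪ Fin (2 * m),
      Measurable fun z : Fin (2 * m) → X => f (z ∘ e) := fun e =>
    hf.comp (measurable_pi_iff.2 fun i => measurable_pi_apply (e i))
  obtain ⟨σ, hσ⟩ : ∃ σ : Equiv.Perm (Fin (2 * m)), ∀ i, σ (e₀ i) = e i := by
    have := Equiv.Perm.isMultiplyPretransitive (Fin (2 * m)) l
    obtain ⟨σ, hσ⟩ := MulAction.exists_smul_eq (Equiv.Perm (Fin (2 * m))) e₀ e
    exact ⟨σ, fun i => by rw [← hσ]; rfl⟩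
  rw [buresLaw, lintegral_withDensity_eq_lintegral_mul _ hDm (hcomp e)]
  set H : (Fin (2 * m) → X) → ℝ≥0∞ := fun z => D z * f (z ∘ e₀) with hH
  have hHm : Measurable H := hDm.mul (hcomp e₀)
  have h1 : ∀ z, (D * fun z => f (z ∘ e)) z = H (z ∘ σ) := by
    intro z
    simp only [Pi.mul_apply, hH, hD, Function.comp_apply, h.buresDensity_perm σ z]
    congr 2
    funext i
    exact congrArg z (hσ i).symm
  rw [lintegral_congr h1, (measurePreserving_pi_comp_perm μ σ).lintegral_comp hHm,
    lintegral_pi_fin_append μ hl H hHm]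
  refine lintegral_congr fun x => ?_
  rw [← h.lintegral_buresSection hl.symm x, ← lintegral_mul_const' _ _
    (ENNReal.inv_ne_top.2 (ENNReal.ofReal_pos.2 h.const_pos).ne'), ← lintegral_const_mul]
  · refine lintegral_congr fun y => ?_
    have h2 : (fun i : Fin (2 * m) => Fin.append x y (Fin.cast hl i)) ∘ e₀ = x := by
      funext i
      exact Fin.append_left x y i
    have h3 : buresDensity (fun i : Fin (2 * m) => ((Fin.append x y (Fin.cast hl i) : X) : ℝ)) =
        buresSection x k y := by
      have key : ∀ (n : ℕ) (hn : n = l + k),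
          buresDensity (fun i : Fin n => ((Fin.append x y (Fin.cast hn i) : X) : ℝ)) =
            buresSection x k y := by
        intro n hn
        subst hn
        rfl
      exact key _ hl
    simp only [hH, hD]
    rw [h2, h3, ENNReal.ofReal_div_of_pos h.const_pos, div_eq_mul_inv, mul_comm]
  · exact ((measurable_buresSection x k).ennreal_ofReal).mul_const _

theorem BuresAdmissible.lintegral_sum_embedding {m : ℕ} {μ : Measure X} [SFinite μ]
    (h : BuresAdmissible m μ) (l : ℕ) (f : (Fin l → X) → ℝ≥0∞) (hf : Measurable f) :
    ∫⁻ z, ∑ e : Fin l ↪ Fin (2 * m), f (z ∘ e) ∂(buresLaw m μ) =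
      ∫⁻ x, f x * ENNReal.ofReal (pfaffian (kernelMatrix (buresKernel m μ) x))
        ∂(Measure.pi fun _ : Fin l => μ) := by
  have := h.isProbabilityMeasure_law
  have hcomp : ∀ e : Fin l ↪ Fin (2 * m),
      Measurable fun z : Fin (2 * m) → X => f (z ∘ e) := fun e =>
    hf.comp (measurable_pi_iff.2 fun i => measurable_pi_apply (e i))
  rcases Nat.eq_zero_or_pos l with rfl | hl0
  · -- no sigma-finiteness is available when `m = 0`, but there is a single empty tuple
    have h1 : ∀ x : Fin 0 → X, pfaffian (kernelMatrix (buresKernel m μ) x) = 1 := fun x => by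
      simp [pfaffian]
    have h2 : ∀ x : Fin 0 → X, f x = f Fin.elim0 := fun x => congrArg f (Subsingleton.elim _ _)
    simp only [h1, h2, ENNReal.ofReal_one, mul_one, lintegral_const, measure_univ,
      Measure.pi_empty_univ, Finset.sum_const, Finset.card_univ, Fintype.card_embedding_eq]
    simp
  rcases le_or_gt l (2 * m) with hl | hl
  · have := h.isFiniteMeasure (by omega)
    obtain ⟨k, hk⟩ := Nat.exists_eq_add_of_le hl
    rw [lintegral_finsetSum _ fun e _ => hcomp e,
      Finset.sum_congr rfl fun e _ => h.lintegral_embedding hk f hf e, Finset.sum_const,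
      Finset.card_univ, Fintype.card_embedding_eq, Fintype.card_fin, Fintype.card_fin,
      nsmul_eq_mul, ← lintegral_const_mul' _ _ (ENNReal.natCast_ne_top _)]
    refine lintegral_congr fun x => ?_
    rw [mul_left_comm]
    congr 1
    have hG := (h.bordered_nonneg_and_pos k (List.ofFn x) (by simp; omega)).1
    have h0 := h.bordered_nil_pos
    rw [← div_eq_mul_inv, ← ENNReal.ofReal_div_of_pos h.const_pos, ← ENNReal.ofReal_natCast,
      ← ENNReal.ofReal_mul (Nat.cast_nonneg _)]
    congr 1
    have hfac : ((2 * m)! : ℝ) = (k ! : ℝ) * ((2 * m).descFactorial l : ℝ) := by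
      rw [← Nat.factorial_mul_descFactorial hl, Nat.cast_mul]
      congr 3
      omega
    have hd : (0 : ℝ) < ((2 * m).descFactorial l : ℝ) :=
      Nat.cast_pos.2 (Nat.descFactorial_pos.2 hl)
    have hk0 : (0 : ℝ) < (k ! : ℝ) := Nat.cast_pos.2 (Nat.factorial_pos _)
    rw [h.buresTau_eq, h.bordered_ofFn, hfac]
    field_simp
  · have : IsEmpty (Fin l ↪ Fin (2 * m)) := ⟨fun e => by
      have := Fintype.card_le_of_embedding e
      simp only [Fintype.card_fin] at this
      omega⟩
    simp [h.pfaffian_eq_zero hl]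

theorem BuresAdmissible.pfaffian_law {m : ℕ} {μ : Measure X} [SFinite μ]
    (h : BuresAdmissible m μ) : IsPfaffianPointProcess (buresLaw m μ) μ (buresKernel m μ) where
  isProbabilityMeasure := h.isProbabilityMeasure_law
  ae_injective := by
    rw [buresLaw, ae_withDensity_iff (measurable_law_density m μ)]
    refine Filter.Eventually.of_forall fun z hz => ?_
    by_contra hinj
    refine hz ?_
    rw [buresDensity_eq_zero fun hi => hinj fun i j hij => hi (congrArg Subtype.val hij)]
    simp
  pfaffian_nonneg _ x := h.pfaffian_nonneg x
  lintegral_sum := h.lintegral_sum_embedding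

end

theorem mainTheorem4 (X : Set ℝ) (hX : X ⊆ Set.Ioi 0) (μ : Measure X) [SFinite μ] (m : ℕ)
    (hmoment : ∀ i j : Fin (2 * m), Integrable
      (fun p : X × X => (p.1 : ℝ) ^ (i : ℕ) * (p.2 : ℝ) ^ (j : ℕ) * buresEps p.1 p.2) (μ.prod μ))
    (hμ : ∀ F : Finset X, F.card < 2 * m → μ ((F : Set X)ᶜ) ≠ 0) :
    -- the moment matrix is skew-symmetric and invertible
    ((buresMoment m μ).transpose = -buresMoment m μ ∧ IsUnit (buresMoment m μ)) ∧
    -- its Pfaffian is, up to the sign `(-1)^m`, the partition function `τ_{2m}`, which is positive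
    (Integrable (fun z : Fin (2 * m) → X => buresDensity (fun i => (z i : ℝ)))
        (Measure.pi fun _ => μ) ∧
      0 < buresTau (2 * m) μ ∧
      buresTau (2 * m) μ = (-1) ^ m * pfaffian (buresMoment m μ)) ∧
    -- the kernel is well defined and skew-symmetric
    ((∀ (x : X) (j : Fin (2 * m)),
        Integrable (fun y : X => buresEps x y * (y : ℝ) ^ (j : ℕ)) μ) ∧
      ∀ x y : X, (buresKernel m μ x y).transpose = -buresKernel m μ y x) ∧
    -- the correlation functions are well defined and are Pfaffians of the kernel
    (∀ (l : ℕ), l ≤ 2 * m → ∀ x : Fin l → X,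
      Integrable (buresSection x (2 * m - l)) (Measure.pi fun _ => μ) ∧
      buresCorrelation m μ x = pfaffian (kernelMatrix (buresKernel m μ) x)) ∧
    -- the normalized Bures density is the law of a Pfaffian point process with this kernel
    IsPfaffianPointProcess (buresLaw m μ) μ (buresKernel m μ) := by
  have h : BuresAdmissible m μ := ⟨hX, hmoment, hμ⟩
  refine ⟨⟨?_, (buresSystem m μ).isUnit_moment h.bordered_nil_pos.ne'⟩,
    ⟨h.integrable_buresDensity, ?_, ?_⟩,
    ⟨fun x j => integrable_buresEps_mul_pow hX (h.integrable_pow j) x,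
      fun x y => (buresSystem m μ).kernel_skew x y⟩,
    fun l hl x => ⟨h.integrable_buresSection (Nat.add_sub_cancel' hl) x,
      h.buresCorrelation_eq hl x⟩,
    h.pfaffian_law⟩
  · ext i j
    exact (buresSystem m μ).moment_skew j i
  · rw [h.buresTau_eq]
    exact h.bordered_nil_pos
  · rw [h.buresTau_eq]
    exact (buresSystem m μ).bordered_nil
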